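/- Let $p$ be a prime. All rings are commutative with unity. Let $R_0\xrightarrow{t_0}R_1\xrightarrow{t_1}R_2\to\cdots$ be a tower of rings and let $I_0\subseteq R_0$ be an ideal. For an $R_0$-module $M$ let $M_{I_0\text{-tor}}$ be the set of $m\in M$ such that every $x\in I_0$ satisfies $x^nm=0$ for some $n>0$. The tower is called a *perfectoid tower arising from* $(R_0,I_0)$ if the following hold. (a) $p\in I_0$. (b) For every $i\ge 0$ the map $\overline{t_i}:R_i/I_0R_i\to R_{i+1}/I_0R_{i+1}$ induced by $t_i$ is injective. (c) For every $i\ge 0$ the image of the Frobenius endomorphism of $R_{i+1}/I_0R_{i+1}$ is contained in the image of $\overline{t_i}$. Hence there is a unique ring map $F_i:R_{i+1}/I_0R_{i+1}\to R_i/I_0R_i$ (the $i$-th Frobenius projection) with $\overline{t_i}(F_i(x))=x^p$ for all $x$. (d) Every $F_i$ is surjective. (e) For every $i\ge 0$, $I_0R_i$ is contained in the Jacobson radical of $R_i$. (f) $I_0$ is principal, and there is a principal ideal $I_1\subseteq R_1$ such that $I_1^p=I_0R_1$ and $\ker(F_i)=I_1(R_{i+1}/I_0R_{i+1})$ for every $i\ge0$.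 (g) For every $i\ge 0$, $I_0(R_i)_{I_0\text{-tor}}=(0)$, and there is a bijective map $(F_i)_{\mathrm{tor}}:(R_{i+1})_{I_0\text{-tor}}\to(R_i)_{I_0\text{-tor}}$ such that $(F_i)_{\mathrm{tor}}(m)\bmod I_0R_i=F_i(m\bmod I_0R_{i+1})$ for all $m$. For such a tower, the $i$-th small tilt is the ring $$R_i^{s.\flat}:=\varprojlim\{\cdots\xrightarrow{F_{i+1}}R_{i+1}/I_0R_{i+1}\xrightarrow{F_i}R_i/I_0R_i\},$$ and $\Phi^{(i)}_0:R_i^{s.\flat}\to R_i/I_0R_i$ denotes the projection to the last term. For a ring $A$, let $\mathbf{F.\acute{E}t}(A)$ be the category of finite étale $A$-algebras. **Proposition.** Let $(\{R_i\}_{i\ge0},\{t_i\}_{i\ge0})$ be a perfectoid tower arising from $(R_0,I_0)$, and assume that $R_i$ is $I_0$-adically Henselian (i.e. $(R_i,I_0R_i)$ is a Henselian pair) for every $i\ge0$. Then for every $i\ge0$ there is an equivalence of categories $$\mathbf{F.\acute{E}t}(R_i^{s.\flat})\xrightarrow{\ \cong\ }\mathbf{F.\acute{E}t}(R_i)$$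 which is compatible, up to natural isomorphism, with the base change functors from $\mathbf{F.\acute{E}t}(R_i)$ and $\mathbf{F.\acute{E}t}(R_i^{s.\flat})$ to $\mathbf{F.\acute{E}t}(R_i/I_0R_i)$ along the quotient map $R_i\to R_i/I_0R_i$ and along $\Phi^{(i)}_0$. -/

import Mathlib

universe u

namespace PerfectoidTower

section

/-- The composite `R₀ → R₁ → ⋯ → Rᵢ` of the transition maps of a tower of rings
`R₀ --t₀--> R₁ --t₁--> ⋯`. -/
def toLayer {R : ℕ → Type u} [∀ i, CommRing (R i)] (t : ∀ i, R i →+* R (i + 1)) :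
    ∀ i, R 0 →+* R i
  | 0 => RingHom.id (R 0)
  | i + 1 => (t i).comp (toLayer t i)

variable {R : ℕ → Type u} [∀ i, CommRing (R i)] (t : ∀ i, R i →+* R (i + 1)) (I₀ : Ideal (R 0))

/-- The extended ideal `I₀Rᵢ` of the `i`-th layer. -/
def layerIdeal (i : ℕ) : Ideal (R i) := I₀.map (toLayer t i)

/-- The quotient `Rᵢ/I₀Rᵢ`. -/
abbrev LayerQuot (i : ℕ) : Type u := R i ⧸ layerIdeal t I₀ i

theorem layerIdeal_succ (i : ℕ) :
    layerIdeal t I₀ (i + 1) = (layerIdeal t I₀ i).map (t i) := by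
  rw [layerIdeal, layerIdeal, Ideal.map_map, toLayer]

theorem layerIdeal_le_comap (i : ℕ) :
    layerIdeal t I₀ i ≤ (layerIdeal t I₀ (i + 1)).comap (t i) := by
  rw [layerIdeal_succ]
  exact Ideal.le_comap_map

/-- The ring map `Rᵢ/I₀Rᵢ → Rᵢ₊₁/I₀Rᵢ₊₁` induced by `tᵢ`. -/
def tbar (i : ℕ) : LayerQuot t I₀ i →+* LayerQuot t I₀ (i + 1) :=
  Ideal.quotientMap (layerIdeal t I₀ (i + 1)) (t i) (layerIdeal_le_comap t I₀ i)

/-- The tower `R₀ → R₁ → ⋯` is a `p`-purely inseparable tower arising from `(R₀, I₀)`. -/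
structure IsPurelyInseparable (p : ℕ) : Prop where
  p_mem : (p : R 0) ∈ I₀
  tbar_injective : ∀ i, Function.Injective (tbar t I₀ i)
  frobenius_mem_range : ∀ (i : ℕ) (x : LayerQuot t I₀ (i + 1)), ∃ y, tbar t I₀ i y = x ^ p

variable {t I₀}

theorem natCast_layerQuot_eq_zero {p : ℕ} (hp : (p : R 0) ∈ I₀) (i : ℕ) :
    (p : LayerQuot t I₀ i) = 0 := by
  rw [← map_natCast (Ideal.Quotient.mk (layerIdeal t I₀ i)), Ideal.Quotient.eq_zero_iff_mem,
    ← map_natCast (toLayer t i)]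
  exact Ideal.mem_map_of_mem _ hp

/-- The `i`-th Frobenius projection `Fᵢ : Rᵢ₊₁/I₀Rᵢ₊₁ → Rᵢ/I₀Rᵢ` of a purely inseparable tower:
the unique map with `tbar i (Fᵢ x) = x ^ p` for all `x` (see `tbar_frobProj`). -/
noncomputable def frobProj {p : ℕ} [hp : Fact p.Prime] (h : IsPurelyInseparable t I₀ p) (i : ℕ) :
    LayerQuot t I₀ (i + 1) →+* LayerQuot t I₀ i where
  toFun x := (h.frobenius_mem_range i x).choose
  map_one' := h.tbar_injective i <| by
    rw [(h.frobenius_mem_range i 1).choose_spec, one_pow, map_one]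
  map_mul' x y := h.tbar_injective i <| by
    rw [map_mul, (h.frobenius_mem_range i _).choose_spec, (h.frobenius_mem_range i _).choose_spec,
      (h.frobenius_mem_range i _).choose_spec, mul_pow]
  map_zero' := h.tbar_injective i <| by
    rw [(h.frobenius_mem_range i 0).choose_spec, zero_pow hp.out.ne_zero, map_zero]
  map_add' x y := h.tbar_injective i <| by
    rw [map_add, (h.frobenius_mem_range i _).choose_spec, (h.frobenius_mem_range i _).choose_spec,
      (h.frobenius_mem_range i _).choose_spec]
    obtain ⟨r, hr⟩ := exists_add_pow_prime_eq hp.out x y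
    rw [hr, natCast_layerQuot_eq_zero h.p_mem]
    ring

theorem tbar_frobProj {p : ℕ} [Fact p.Prime] (h : IsPurelyInseparable t I₀ p) (i : ℕ)
    (x : LayerQuot t I₀ (i + 1)) : tbar t I₀ i (frobProj h i x) = x ^ p :=
  (h.frobenius_mem_range i x).choose_spec

variable (t I₀)

/-- The ideal `(Rᵢ)_{I₀-tor}` of `I₀`-torsion elements of `Rᵢ`: those `m` such that every `x ∈ I₀`
satisfies `xⁿ m = 0` for some `n > 0`. -/
def layerTorsion (i : ℕ) : Ideal (R i) where
  carrier := {m | ∀ x ∈ I₀, ∃ n : ℕ, 0 < n ∧ toLayer t i x ^ n * m = 0}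
  zero_mem' := fun _ _ => ⟨1, one_pos, mul_zero _⟩
  add_mem' := by
    intro a b ha hb x hx
    obtain ⟨n, hn, h1⟩ := ha x hx
    obtain ⟨k, -, h2⟩ := hb x hx
    refine ⟨n + k, by omega, ?_⟩
    have e : toLayer t i x ^ (n + k) * (a + b)
        = toLayer t i x ^ k * (toLayer t i x ^ n * a)
          + toLayer t i x ^ n * (toLayer t i x ^ k * b) := by ring
    rw [e, h1, h2, mul_zero, mul_zero, add_zero]
  smul_mem' := by
    intro c a ha x hx
    obtain ⟨n, hn, h1⟩ := ha x hx
    refine ⟨n, hn, ?_⟩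
    rw [smul_eq_mul, mul_left_comm, h1, mul_zero]

/-- The tower `R₀ → R₁ → ⋯` is a (`p`-)perfectoid tower arising from `(R₀, I₀)`. -/
structure IsPerfectoidTower (p : ℕ) [Fact p.Prime] : Prop extends IsPurelyInseparable t I₀ p where
  frobProj_surjective : ∀ i, Function.Surjective (frobProj toIsPurelyInseparable i)
  /-- every `Rᵢ` is `I₀`-adically Zariskian -/
  zariskian : ∀ i, layerIdeal t I₀ i ≤ Ideal.jacobson ⊥
  isPrincipal : I₀.IsPrincipal
  /-- a principal ideal `I₁` of `R₁` with `I₁ᵖ = I₀R₁` and `ker Fᵢ = I₁(Rᵢ₊₁/I₀Rᵢ₊₁)` for all `i`;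
  here `toLayer (fun k => t (k + 1)) i` is the transition map `R₁ → Rᵢ₊₁` -/
  exists_pillar : ∃ I₁ : Ideal (R 1), I₁.IsPrincipal ∧ I₁ ^ p = layerIdeal t I₀ 1 ∧
    ∀ i, RingHom.ker (frobProj toIsPurelyInseparable i) =
      (I₁.map (toLayer (R := fun k => R (k + 1)) (fun k => t (k + 1)) i)).map
        (Ideal.Quotient.mk (layerIdeal t I₀ (i + 1)))
  mul_torsion : ∀ i, layerIdeal t I₀ i * layerTorsion t I₀ i = ⊥
  /-- the bijection `(Fᵢ)_tor` between torsion parts that is compatible with `Fᵢ` -/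
  exists_frobProj_torsion : ∀ i, ∃ Ftor : layerTorsion t I₀ (i + 1) → layerTorsion t I₀ i,
    Function.Bijective Ftor ∧ ∀ m : layerTorsion t I₀ (i + 1),
      Ideal.Quotient.mk (layerIdeal t I₀ i) (Ftor m : R i) =
        frobProj toIsPurelyInseparable i (Ideal.Quotient.mk (layerIdeal t I₀ (i + 1)) (m : R (i + 1)))

variable {t I₀}

/-- The `j`-th small tilt `Rⱼ^{s.♭}`: the inverse limit of
`⋯ → Rⱼ₊₂/I₀Rⱼ₊₂ → Rⱼ₊₁/I₀Rⱼ₊₁ → Rⱼ/I₀Rⱼ` along the Frobenius projections, as a ring of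
compatible sequences. -/
def smallTilt {p : ℕ} [Fact p.Prime] (h : IsPerfectoidTower t I₀ p) (j : ℕ) :
    Subring (∀ m : ℕ, LayerQuot t I₀ (j + m)) where
  carrier := {a | ∀ m : ℕ, frobProj h.toIsPurelyInseparable (j + m) (a (m + 1)) = a m}
  one_mem' := fun _ => map_one _
  zero_mem' := fun _ => map_zero _
  mul_mem' := by
    intro a b ha hb m
    simp only [Pi.mul_apply]
    rw [← ha m, ← hb m]
    exact map_mul (frobProj h.toIsPurelyInseparable (j + m)) (a (m + 1)) (b (m + 1))
  add_mem' := by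
    intro a b ha hb m
    simp only [Pi.add_apply]
    rw [← ha m, ← hb m]
    exact map_add (frobProj h.toIsPurelyInseparable (j + m)) (a (m + 1)) (b (m + 1))
  neg_mem' := by
    intro a ha m
    simp only [Pi.neg_apply]
    rw [← ha m]
    exact map_neg (frobProj h.toIsPurelyInseparable (j + m)) (a (m + 1))

/-- The `0`-th projection `Φ₀ : Rⱼ^{s.♭} → Rⱼ/I₀Rⱼ`, `(aₘ)ₘ ↦ a₀`. -/
def smallTiltProj {p : ℕ} [Fact p.Prime] (h : IsPerfectoidTower t I₀ p) (j : ℕ) :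
    smallTilt h j →+* LayerQuot t I₀ j :=
  (Pi.evalRingHom (fun m : ℕ => LayerQuot t I₀ (j + m)) 0).comp (smallTilt h j).subtype

end

/-- The base change functor `C ↦ B ⊗_A C` on finite étale algebras along a ring map `f : A → B`. -/
noncomputable def baseChangeAlong {A B : Type u} [CommRing A] [CommRing B] (f : A →+* B) :
    CategoryTheory.Functor (CommAlgCat.FiniteEtale.{u} A) (CommAlgCat.FiniteEtale.{u} B) :=
  letI := f.toAlgebra
  CommAlgCat.FiniteEtale.baseChange A B

end PerfectoidTower

open PerfectoidTower CategoryTheory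

/-! Both `Rᵢ → Rᵢ/I₀Rᵢ` and `Φ₀ : Rᵢ^{s.♭} → Rᵢ/I₀Rᵢ` are surjections whose source is Henselian
along the kernel. For such a surjection `R → S`, base change is an equivalence on finite étale
algebras (`baseChange_isEquivalence`), so the desired equivalence is the first reduction functor
followed by a quasi-inverse of the second.

The tilt is Henselian because it is a limit of surjections `Fᵢ` with nil kernels: `Fᵢ x = 0` forces
`x ^ p = 0`. A simple root therefore lifts uniquely at each level (`henselianRing_of_limit`).

The bulk of the work starts from the definition of a Henselian pair, lifting of simple roots of
monic polynomials, and climbs to finite étale algebras. Root lifting, applied to a characteristic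
polynomial, lifts idempotents of rank one. These lift sections of étale localizations of finite
algebras, in particular of universal coprime factorization rings. Hence coprime factorizations lift,
and with them all idempotents of finite algebras (`exists_isIdempotentElem_sub_mem`).

Full faithfulness: a map `B → C ⊗ S` is a point of `C ⊗ B`, cut out modulo `I` by an idempotent,
which lifts. Essential surjectivity: lift the equations of an étale algebra, then use Zariski's main
theorem and one more idempotent to split off a finite piece with the same reduction. -/

namespace HenselianPair

/-! ### Nakayama, Cayley–Hamilton, and idempotents of rank one -/

open Polynomial

/-- If `B` is integral over `R` and `I` lies in the Jacobson radical of `R`, then `IB` lies in the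
Jacobson radical of `B`. -/
theorem map_le_jacobson_bot_of_isIntegral {R B : Type*} [CommRing R] [CommRing B] [Algebra R B]
    [Algebra.IsIntegral R B] {I : Ideal R} (hI : I ≤ Ideal.jacobson ⊥) :
    I.map (algebraMap R B) ≤ Ideal.jacobson ⊥ := by
  rw [Ideal.jacobson, le_sInf_iff]
  rintro M ⟨-, hM⟩
  have : (M.comap (algebraMap R B)).IsMaximal :=
    Ideal.isMaximal_comap_of_isIntegral_of_isMaximal M
  rw [Ideal.map_le_iff_le_comap]
  exact hI.trans (sInf_le ⟨bot_le, this⟩)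

theorem isUnit_of_sub_one_mem {R : Type*} [CommRing R] {I : Ideal R}
    (hI : I ≤ Ideal.jacobson ⊥) {x : R} (hx : x - 1 ∈ I) : IsUnit x := by
  simpa using Ideal.mem_jacobson_bot.mp (hI hx) 1

/-- Nakayama's lemma for the structure map of a finite algebra. -/
theorem algebraMap_surjective_of_le_jacobson {R B : Type*} [CommRing R] [CommRing B] [Algebra R B]
    [Module.Finite R B] {I : Ideal R} (hI : I ≤ Ideal.jacobson ⊥)
    (h : ∀ b : B, ∃ r : R, b - algebraMap R B r ∈ I.map (algebraMap R B)) :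
    Function.Surjective (algebraMap R B) := by
  have key : (⊤ : Submodule R B) ≤ LinearMap.range (Algebra.linearMap R B) := by
    refine Submodule.le_of_le_smul_of_le_jacobson_bot (I := I) Module.Finite.fg_top hI ?_
    intro b _
    obtain ⟨r, hr⟩ := h b
    rw [Ideal.smul_top_eq_map]
    exact Submodule.mem_sup.mpr ⟨_, ⟨r, rfl⟩, _, hr, by simp⟩
  intro b
  obtain ⟨r, hr⟩ := key (Submodule.mem_top : b ∈ ⊤)
  exact ⟨r, hr⟩

/-- **Cayley–Hamilton** for multiplication by an element of a finite algebra. -/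
theorem aeval_charpoly_eq_zero_of_matrix {R B ι : Type*} [CommRing R] [CommRing B] [Algebra R B]
    [Fintype ι] [DecidableEq ι] (b : ι → B) (hb : Submodule.span R (Set.range b) = ⊤) (e : B)
    (M : Matrix ι ι R) (hM : ∀ j, e * b j = ∑ l, M l j • b l) :
    aeval e M.charpoly = 0 := by
  have key : ∀ p : R[X], ∀ v : ι → R, Fintype.linearCombination R b (aeval (Matrix.toLin' M) p v) =
      aeval e p * Fintype.linearCombination R b v := by
    intro p
    induction p using Polynomial.induction_on' with
    | add p q hp hq => intro v; simp only [map_add, LinearMap.add_apply, hp, hq, add_mul]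
    | monomial n a =>
      have h1 : ∀ v, Fintype.linearCombination R b (Matrix.toLin' M v) =
          e * Fintype.linearCombination R b v := by
        intro v
        simp only [Fintype.linearCombination_apply, Matrix.toLin'_apply, Matrix.mulVec, dotProduct,
          Finset.sum_smul, Finset.mul_sum, mul_smul_comm, hM, Finset.smul_sum]
        rw [Finset.sum_comm]
        refine Finset.sum_congr rfl fun j _ => Finset.sum_congr rfl fun l _ => ?_
        rw [smul_smul, mul_comm]
      have h2 : ∀ n : ℕ, ∀ v, Fintype.linearCombination R b ((Matrix.toLin' M ^ n) v) =
          e ^ n * Fintype.linearCombination R b v := by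
        intro n
        induction n with
        | zero => intro v; simp
        | succ n ih => intro v; rw [pow_succ, Module.End.mul_apply, ih, h1, pow_succ, mul_assoc]
      intro v
      rw [aeval_monomial, aeval_monomial, Module.End.mul_apply, Module.algebraMap_end_apply,
        map_smul, h2, ← Algebra.smul_def, smul_mul_assoc]
  have h0 : aeval (Matrix.toLin' M) M.charpoly = 0 := by
    have := Matrix.aeval_self_charpoly M
    have h' := congrArg (Matrix.toLinAlgEquiv' (R := R) (n := ι)) this
    rw [map_zero] at h'
    rw [← h']
    exact (Polynomial.aeval_algHom_apply (Matrix.toLinAlgEquiv' (R := R) (n := ι)).toAlgHom M _)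
  have h1 : (1 : B) ∈ LinearMap.range (Fintype.linearCombination R b) := by
    rw [Fintype.range_linearCombination, hb]; trivial
  obtain ⟨v, hv⟩ := h1
  have := key M.charpoly v
  rw [h0, hv, mul_one] at this
  simpa using this.symm

theorem charpoly_diagonal_option {R : Type*} [CommRing R] (n : ℕ) :
    (Matrix.diagonal (fun o : Option (Fin n) => if o = none then (1 : R) else 0)).charpoly =
      X ^ n * (X - 1) := by
  have : (Matrix.diagonal (fun o : Option (Fin n) => if o = none then (1 : R) else 0)).charmatrix =
      Matrix.diagonal (fun o : Option (Fin n) => if o = none then (X - 1 : R[X]) else X) := by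
    ext1 i j
    rw [Matrix.charmatrix_apply]
    by_cases h : i = j
    · subst h
      by_cases h' : i = none <;> simp [h']
    · simp [h]
  rw [Matrix.charpoly, this, Matrix.det_diagonal, Fintype.prod_option]
  simp [mul_comm]

/-- Over a Henselian pair `(R, I)`, an idempotent of `B/IB` (`B` a finite `R`-algebra) that cuts out
a quotient of `R` lifts to an idempotent of `B`. -/
theorem exists_isIdempotentElem_of_rank_one {R B : Type*} [CommRing R] [CommRing B] [Algebra R B]
    [Module.Finite R B] (I : Ideal R) [HenselianRing R I] (e : B)
    (he : e * e - e ∈ I.map (algebraMap R B))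
    (h : ∀ b : B, ∃ r : R, e * b - e * algebraMap R B r ∈ I.map (algebraMap R B)) :
    ∃ e' : B, IsIdempotentElem e' ∧ e' - e ∈ I.map (algebraMap R B) := by
  classical
  set K := I.map (algebraMap R B) with hK
  obtain ⟨n, c, hc⟩ := Module.Finite.exists_fin (R := R) (M := B)
  -- pad with a zero so that the index set has at least two elements
  let c' : Fin (n + 1) → B := Fin.cons 0 c
  let b : Option (Fin (n + 1)) → B := fun o => o.elim e (fun j => (1 - e) * c' j)
  have hb : Submodule.span R (Set.range b) = ⊤ := by
    rw [eq_top_iff]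
    refine Submodule.le_of_le_smul_of_le_jacobson_bot (I := I) Module.Finite.fg_top
      HenselianRing.jac ?_
    rw [← hc, Submodule.span_le]
    rintro _ ⟨j, rfl⟩
    obtain ⟨r, hr⟩ := h (c j)
    have e1 : c j = (r • e + (1 - e) * c j) + (e * c j - e * algebraMap R B r) := by
      rw [Algebra.smul_def]; ring
    rw [e1]
    refine Submodule.add_mem_sup (Submodule.add_mem _ (Submodule.smul_mem _ _ ?_) ?_) ?_
    · exact Submodule.subset_span ⟨none, rfl⟩
    · exact Submodule.subset_span ⟨some j.succ, by simp [b, c']⟩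
    · rw [hc, Ideal.smul_top_eq_map]; exact hr
  let d : Option (Fin (n + 1)) → R := fun o => if o = none then 1 else 0
  have hd : ∀ j, ∃ a : Option (Fin (n + 1)) → R, (∀ l, a l ∈ I) ∧
      e * b j - d j • b j = ∑ l, a l • b l := by
    intro j
    have hmem : e * b j - d j • b j ∈ I • Submodule.span R (Set.range b) := by
      rw [hb, Ideal.smul_top_eq_map]
      change _ ∈ K
      cases j with
      | none => simpa [b, d] using he
      | some j =>
        have : e * b (some j) - d (some j) • b (some j) = -(e * e - e) * c' j := by
          simp [b, d]; ring
        rw [this]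
        exact K.mul_mem_right _ (K.neg_mem he)
    rw [Submodule.mem_ideal_smul_span_iff_exists_sum] at hmem
    obtain ⟨a, ha, hs⟩ := hmem
    refine ⟨a, ha, ?_⟩
    rw [← hs, Finsupp.sum_fintype]
    simp
  choose a haI ha using hd
  -- `M` represents multiplication by `e` on the generators `e` and `(1 - e) c'ⱼ`. Since `e (1 - e)
  -- ∈ IB`, it can be chosen congruent to `diag(1, 0, …, 0)` modulo `I`.
  let M : Matrix (Option (Fin (n + 1))) (Option (Fin (n + 1))) R :=
    Matrix.diagonal d + Matrix.of fun l j => a j l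
  have hM : ∀ j, e * b j = ∑ l, M l j • b l := by
    intro j
    simp only [M, Matrix.add_apply, add_smul, Finset.sum_add_distrib, Matrix.of_apply, ← ha j,
      Matrix.diagonal_apply]
    simp
  have hf0 := aeval_charpoly_eq_zero_of_matrix b hb e M hM
  set f := M.charpoly with hf
  have hmon : f.Monic := M.charpoly_monic
  let q := Ideal.Quotient.mk I
  have hfbar : f.map q = X ^ (n + 1) * (X - 1) := by
    rw [hf, ← Matrix.charpoly_map, ← charpoly_diagonal_option]
    congr 1
    ext i j
    have : q (a j i) = 0 := Ideal.Quotient.eq_zero_iff_mem.mpr (haI j i)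
    by_cases hij : i = j
    · subst hij; simp [M, d, this, apply_ite q]
    · simp [M, this, hij]
  have hev : ∀ g : R[X], ∀ x, q (g.eval x) = (g.map q).eval (q x) := fun g x => by
    rw [Polynomial.eval_map, eval₂_at_apply]
  -- The derivative of `X ^ (n + 1) * (X - 1)` at `1` is `1`, so this root is simple.
  obtain ⟨s, hs, hs1⟩ := HenselianRing.is_henselian (I := I) f hmon 1
    (by rw [← Ideal.Quotient.eq_zero_iff_mem]; change q _ = 0; rw [hev, hfbar]; simp)
    (by change IsUnit (q _); rw [hev, ← derivative_map, hfbar]; simp)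
  have hqs : q s = 1 := by
    rw [← sub_eq_zero, ← map_one q, ← map_sub]; exact Ideal.Quotient.eq_zero_iff_mem.mpr hs1
  set g := f /ₘ (X - C s) with hg
  have hfg : (X - C s) * g = f := mul_divByMonic_eq_iff_isRoot.mpr hs
  have hgbar : g.map q = X ^ (n + 1) := by
    rw [hg, map_divByMonic _ (monic_X_sub_C s), hfbar]
    have : (X - C s).map q = X - 1 := by simp [hqs]
    rw [this, mul_comm, mul_divByMonic_cancel_left]
    simpa using monic_X_sub_C (1 : R ⧸ I)
  have hgs : IsUnit (g.eval s) := by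
    have := isLocalHom_of_le_jacobson_bot I HenselianRing.jac
    refine IsUnit.of_map q _ ?_
    rw [hev, hgbar, hqs]
    simp
  obtain ⟨u, hu⟩ := hgs
  have hroot : (e - algebraMap R B s) * aeval e g = 0 := by
    have := congrArg (aeval e) hfg
    rw [hf0] at this
    simpa using this
  -- `g` is congruent to the constant `g(s)` modulo `X - s`, and `e - s` kills `g(e)`. So `g(e)`
  -- divided by the unit `g(s)` is idempotent.
  have hgg : aeval e g * aeval e g = algebraMap R B u * aeval e g := by
    obtain ⟨w, hw⟩ := X_sub_C_dvd_sub_C_eval (a := s) (p := g)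
    have := congrArg (aeval e) hw
    simp only [map_sub, map_mul, aeval_X, aeval_C] at this
    rw [hu]
    linear_combination aeval e g * this + aeval e w * hroot
  have huu : algebraMap R B ↑u⁻¹ * algebraMap R B u = 1 := by
    rw [← map_mul]; simp
  refine ⟨algebraMap R B ↑u⁻¹ * aeval e g, ?_, ?_⟩
  · rw [IsIdempotentElem]
    linear_combination (algebraMap R B ↑u⁻¹) ^ 2 * hgg + algebraMap R B ↑u⁻¹ * aeval e g * huu
  · have hqu : (u : R) - 1 ∈ I := by
      rw [← Ideal.Quotient.eq_zero_iff_mem]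
      change q _ = 0
      rw [map_sub, hu, hev, hgbar, hqs]; simp
    let Q := Ideal.Quotient.mk K
    have hQI : ∀ x ∈ I, Q (algebraMap R B x) = 0 := fun x hx =>
      Ideal.Quotient.eq_zero_iff_mem.mpr (Ideal.mem_map_of_mem _ hx)
    have hQu : Q (algebraMap R B u) = 1 := by
      have := hQI _ hqu
      rwa [map_sub, map_sub, sub_eq_zero, map_one, map_one] at this
    have hQu' : Q (algebraMap R B ↑u⁻¹) = 1 := by
      have := congrArg Q huu
      rwa [map_mul, hQu, mul_one, map_one] at this
    have hQe : Q e * Q e = Q e := by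
      rw [← sub_eq_zero, ← map_mul, ← map_sub]
      exact Ideal.Quotient.eq_zero_iff_mem.mpr he
    -- The padding makes the exponent positive, so this power of the idempotent `Q e` is `Q e`
    -- itself.
    have hQg : Q (aeval e g) = Q e ^ (n + 1) := by
      have hker : ∃ g' : R[X], g = X ^ (n + 1) + g' ∧ ∀ i, g'.coeff i ∈ I := by
        refine ⟨g - X ^ (n + 1), by ring, fun i => ?_⟩
        rw [← Ideal.Quotient.eq_zero_iff_mem]
        change q _ = 0
        rw [← coeff_map, Polynomial.map_sub, hgbar]; simp
      obtain ⟨g', hg', hgI⟩ := hker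
      rw [hg', map_add, map_add, map_pow, aeval_X, map_pow, add_eq_left, aeval_eq_sum_range, map_sum]
      refine Finset.sum_eq_zero fun i _ => ?_
      rw [Algebra.smul_def, map_mul, hQI _ (hgI i), zero_mul]
    rw [← Ideal.Quotient.eq_zero_iff_mem]
    change Q _ = 0
    rw [map_sub, map_mul, hQu', hQg, one_mul, IsIdempotentElem.pow_succ_eq n hQe, sub_self]

end HenselianPair

/-! ### Separating elements and finite clopen pieces -/

namespace HenselianPair

open Polynomial TensorProduct

/-- A point `τ` of an unramified algebra `E` over a quotient `S` of the base `R` is cut out, modulo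
the kernel of `R → S`, by an element `ε` of `E` with `τ ε = 1`. -/
theorem exists_separating_element {R S E : Type*} [CommRing R] [CommRing S] [CommRing E]
    [Algebra R S] [Algebra R E] [Algebra.FormallyUnramified R E] [Algebra.EssFiniteType R E]
    (hS : Function.Surjective (algebraMap R S)) (τ : E →ₐ[R] S) :
    ∃ ε : E, τ ε = 1 ∧
      ∀ x, τ x = 0 → x * ε ∈ (RingHom.ker (algebraMap R S)).map (algebraMap R E) := by
  set K := (RingHom.ker (algebraMap R S)).map (algebraMap R E) with hK
  let Q : E →ₐ[R] E ⧸ K := Ideal.Quotient.mkₐ R K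
  let θ : S →ₐ[R] E ⧸ K := AlgHom.liftOfSurjective (Algebra.ofId R S) hS (Algebra.ofId R (E ⧸ K)) (by
    intro r hr
    rw [RingHom.mem_ker] at hr ⊢
    change algebraMap R (E ⧸ K) r = 0
    rw [IsScalarTower.algebraMap_apply R E (E ⧸ K)]
    exact Ideal.Quotient.eq_zero_iff_mem.mpr (Ideal.mem_map_of_mem _ hr))
  let τ' : E ⧸ K →ₐ[R] S := Ideal.Quotient.liftₐ K τ (by
    change K ≤ RingHom.ker τ
    rw [hK, Ideal.map_le_iff_le_comap]
    intro r hr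
    rw [Ideal.mem_comap, RingHom.mem_ker, AlgHom.commutes]
    exact hr)
  have hτ' : ∀ x, τ' (Q x) = τ x := fun x => rfl
  have hθ : ∀ s, τ' (θ s) = s := by
    intro s
    obtain ⟨r, rfl⟩ := hS s
    rw [AlgHom.commutes, AlgHom.commutes]
  -- The separability element `el` satisfies `(1 ⊗ x) el = (x ⊗ 1) el`. Under `Θ` this says that `x`
  -- acts on the image of `el` as the scalar `τ x`.
  let Θ : E ⊗[R] E →ₐ[R] E ⧸ K := Algebra.TensorProduct.productMap (θ.comp τ) Q
  let el := Algebra.FormallyUnramified.elem R E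
  obtain ⟨ε, hε⟩ := Ideal.Quotient.mkₐ_surjective R K (Θ el)
  change Q ε = _ at hε
  refine ⟨ε, ?_, fun x hx => ?_⟩
  · have h1 : (τ'.comp Θ) = τ.comp (Algebra.TensorProduct.lmul' R) := by
      ext x
      · simp [Θ, hθ]
      · simp [Θ, hτ']
    rw [← hτ', hε]
    have := DFunLike.congr_fun h1 el
    simp only [AlgHom.comp_apply] at this
    rw [this, Algebra.FormallyUnramified.lmul_elem, map_one]
  · have := congrArg Θ (Algebra.FormallyUnramified.one_tmul_mul_elem (R := R) x)
    rw [← Ideal.Quotient.eq_zero_iff_mem]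
    change Q _ = 0
    rw [map_mul, hε]
    simp only [map_mul, Θ, Algebra.TensorProduct.productMap_apply_tmul, map_one, one_mul, mul_one,
      AlgHom.comp_apply, hx, map_zero, zero_mul] at this
    exact this

/-- The variant of `exists_separating_element` for a localization of a finite algebra, with the
separating element taken in the finite algebra. -/
theorem exists_separating_element_of_isLocalization {R S B E : Type*} [CommRing R] [CommRing S]
    [CommRing B] [CommRing E] [Algebra R S] [Algebra R B] [Algebra R E] [Algebra B E]
    [IsScalarTower R B E] [Module.Finite R B] (Δ : B) [IsLocalization.Away Δ E]
    [Algebra.FormallyUnramified R E] [Algebra.EssFiniteType R E]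
    (hS : Function.Surjective (algebraMap R S)) (τ : E →ₐ[R] S) :
    ∃ e : B, τ (algebraMap B E e) = 1 ∧ ∀ b, τ (algebraMap B E b) = 0 →
      b * e ∈ (RingHom.ker (algebraMap R S)).map (algebraMap R B) := by
  obtain ⟨ε, hε1, hε⟩ := exists_separating_element hS τ
  set I := RingHom.ker (algebraMap R S) with hI
  obtain ⟨n, b, hb⟩ := Module.Finite.exists_fin (R := R) (M := B)
  choose s hs using fun i => hS (τ (algebraMap B E (b i)))
  have hker : ∀ i, τ (algebraMap B E (b i - algebraMap R B (s i))) = 0 := by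
    intro i
    rw [map_sub, map_sub, ← IsScalarTower.algebraMap_apply, AlgHom.commutes, hs, sub_self]
  obtain ⟨m, b0, hb0⟩ := IsLocalization.Away.surj Δ ε
  have hN : ∀ i, ∃ N : ℕ, Δ ^ N * ((b i - algebraMap R B (s i)) * b0) ∈ I.map (algebraMap R B) := by
    intro i
    have h1 := hε _ (hker i)
    have h2 : algebraMap B E ((b i - algebraMap R B (s i)) * b0) ∈
        (I.map (algebraMap R B)).map (algebraMap B E) := by
      rw [map_mul, ← hb0, ← mul_assoc, Ideal.map_map, ← IsScalarTower.algebraMap_eq]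
      exact Ideal.mul_mem_right _ _ h1
    rw [IsLocalization.algebraMap_mem_map_algebraMap_iff (Submonoid.powers Δ)] at h2
    obtain ⟨_, ⟨N, rfl⟩, h⟩ := h2
    exact ⟨N, h⟩
  choose N hN using hN
  -- A common power of `Δ` clearing denominators for all the finitely many generators; `τ Δ` is a
  -- unit, so the value at `τ` can afterwards be rescaled to `1`.
  let N' := ∑ i, N i
  have hunit : IsUnit (τ (algebraMap B E Δ)) :=
    (IsLocalization.Away.algebraMap_isUnit (S := E) Δ).map τ
  have hx : τ (algebraMap B E (Δ ^ N' * b0)) = τ (algebraMap B E Δ) ^ (N' + m) := by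
    rw [map_mul, ← hb0, map_mul, map_mul, hε1, one_mul, map_pow, map_pow, map_pow, pow_add]
  obtain ⟨v, hv⟩ := (hunit.pow (N' + m)).exists_right_inv
  obtain ⟨v, rfl⟩ := hS v
  refine ⟨Δ ^ N' * b0 * algebraMap R B v, ?_, fun k hk => ?_⟩
  · rw [map_mul, map_mul, hx, ← IsScalarTower.algebraMap_apply, AlgHom.commutes, hv]
  · rw [← mul_assoc]
    refine Ideal.mul_mem_right _ _ ?_
    obtain ⟨r, hr⟩ : ∃ r : Fin n → R, ∑ i, r i • b i = k := by
      have : k ∈ Submodule.span R (Set.range b) := by rw [hb]; trivial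
      exact (Submodule.mem_span_range_iff_exists_fun R).mp this
    have hρ : ∑ i, r i * s i ∈ I := by
      rw [hI, RingHom.mem_ker, ← hk, ← hr]
      simp only [map_sum, map_mul, hs, Algebra.smul_def, ← IsScalarTower.algebraMap_apply,
        AlgHom.commutes]
    have hdec : k = ∑ i, algebraMap R B (r i) * (b i - algebraMap R B (s i)) +
        algebraMap R B (∑ i, r i * s i) := by
      rw [← hr, map_sum, ← Finset.sum_add_distrib]
      refine Finset.sum_congr rfl fun i _ => ?_
      rw [Algebra.smul_def, map_mul]; ring
    rw [hdec, add_mul, Finset.sum_mul]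
    refine Ideal.add_mem _ (Ideal.sum_mem _ fun i _ => ?_)
      (Ideal.mul_mem_right _ _ (Ideal.mem_map_of_mem _ hρ))
    have hsplit : Δ ^ N' = Δ ^ (N' - N i) * Δ ^ N i := by
      rw [← pow_add, Nat.sub_add_cancel (Finset.single_le_sum (f := N) (fun _ _ => Nat.zero_le _)
        (Finset.mem_univ i))]
    have : algebraMap R B (r i) * (b i - algebraMap R B (s i)) * (Δ ^ N' * b0) =
        algebraMap R B (r i) * Δ ^ (N' - N i) *
          (Δ ^ N i * ((b i - algebraMap R B (s i)) * b0)) := by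
      rw [hsplit]; ring
    rw [this]
    exact Ideal.mul_mem_left _ _ (hN i)

/-- A finite étale algebra that is trivial modulo an ideal in the Jacobson radical is trivial. -/
theorem algebraMap_bijective_of_etale {C D : Type*} [CommRing C] [CommRing D] [Algebra C D]
    [Module.Finite C D] [Algebra.Etale C D] {J : Ideal C} (hJ : J ≤ Ideal.jacobson ⊥)
    (h1 : ∀ d : D, ∃ c : C, d - algebraMap C D c ∈ J.map (algebraMap C D))
    (h2 : ∀ c : C, algebraMap C D c ∈ J.map (algebraMap C D) → c ∈ J) :
    Function.Bijective (algebraMap C D) := by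
  have hsurj := algebraMap_surjective_of_le_jacobson hJ h1
  refine ⟨?_, hsurj⟩
  -- A surjection that is étale has a finitely generated idempotent kernel; lying in the Jacobson
  -- radical, it vanishes by Nakayama.
  have hid : IsIdempotentElem (RingHom.ker (algebraMap C D)) :=
    (Algebra.FormallyEtale.iff_of_surjective hsurj).mp inferInstance
  have hfg : (RingHom.ker (algebraMap C D)).FG :=
    Algebra.FinitePresentation.ker_fG_of_surjective (Algebra.ofId C D) hsurj
  rw [RingHom.injective_iff_ker_eq_bot]
  have hle : RingHom.ker (algebraMap C D) ≤ J := by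
    intro c hc
    refine h2 c ?_
    rw [RingHom.mem_ker.mp hc]
    exact Ideal.zero_mem _
  refine Submodule.eq_bot_of_le_smul_of_le_jacobson_bot (RingHom.ker (algebraMap C D)) _ hfg ?_
    (hle.trans hJ)
  rw [smul_eq_mul]
  exact hid.ge

/-- A clopen piece of an étale algebra that is finite over the base modulo `I`, and that comes from a
finite algebra, is finite étale. -/
theorem finite_quotient_of_isIdempotentElem {R B E : Type*} [CommRing R] [CommRing B] [CommRing E]
    [Algebra R B] [Algebra R E] [Module.Finite R B] {I : Ideal R} (hI : I ≤ Ideal.jacobson ⊥)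
    (f : B →ₐ[R] E) (e j : B) (hj : (j - 1) * e ∈ I.map (algebraMap R B))
    (h : ∀ x : E, ∃ (N : ℕ) (b : B), f j ^ N * x = f b) :
    Module.Finite R (E ⧸ Ideal.span {1 - f e}) := by
  let q : E →ₐ[R] E ⧸ Ideal.span {1 - f e} := Ideal.Quotient.mkₐ R _
  let φ := q.comp f
  have hqe : q (f e) = 1 := by
    rw [← sub_eq_zero, ← map_one q, ← map_sub]
    change Ideal.Quotient.mk _ (f e - 1) = 0
    rw [Ideal.Quotient.eq_zero_iff_mem, ← Ideal.neg_mem_iff, neg_sub]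
    exact Ideal.mem_span_singleton_self _
  -- Since `e` becomes `1` in the quotient, `j - 1` becomes `(j - 1) e`, an element of `I` times the
  -- image of `B`. That image is finite over `R`, so `j` is already a unit there and the
  -- denominators `j ^ N` disappear.
  have hu : IsUnit (φ.rangeRestrict j : φ.range) := by
    have : Module.Finite R φ.range :=
      Module.Finite.of_surjective φ.rangeRestrict.toLinearMap φ.rangeRestrict_surjective
    refine isUnit_of_sub_one_mem (I := I.map (algebraMap R φ.range))
      (map_le_jacobson_bot_of_isIntegral hI) ?_
    have h1 : φ.rangeRestrict j - 1 = φ.rangeRestrict ((j - 1) * e) := by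
      apply Subtype.ext
      simp [φ, hqe]
    rw [h1]
    have h2 := Ideal.mem_map_of_mem φ.rangeRestrict hj
    have h3 : (I.map (algebraMap R B)).map φ.rangeRestrict = I.map (algebraMap R φ.range) := by
      have : (φ.rangeRestrict : B →+* φ.range).comp (algebraMap R B) = algebraMap R φ.range :=
        φ.rangeRestrict.comp_algebraMap
      rw [← this, ← Ideal.map_map]
      rfl
    rwa [h3] at h2
  obtain ⟨v, hv⟩ := hu.exists_left_inv
  have hsurj : Function.Surjective φ := by
    intro x
    obtain ⟨x, rfl⟩ := Ideal.Quotient.mkₐ_surjective R _ x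
    change ∃ a, φ a = q x
    obtain ⟨N, b, hb⟩ := h x
    have hv' : (v : E ⧸ Ideal.span {1 - f e}) * φ j = 1 := congrArg Subtype.val hv
    have h1 : q x = (v : E ⧸ Ideal.span {1 - f e}) ^ N * φ b := by
      have := congrArg q hb
      rw [map_mul, map_pow] at this
      change φ j ^ N * q x = φ b at this
      rw [← this, ← mul_assoc, ← mul_pow, hv', one_pow, one_mul]
    obtain ⟨w, hw⟩ := v.2
    refine ⟨w ^ N * b, ?_⟩
    rw [h1, map_mul, map_pow]
    exact congrArg (fun y => y ^ N * φ b) hw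
  exact Module.Finite.of_surjective φ.toLinearMap hsurj

/-- Killing `1 - e` is the same as inverting the idempotent `e`, and localizations are étale. -/
theorem etale_quotient_of_isIdempotentElem {R E : Type*} [CommRing R] [CommRing E]
    [Algebra R E] [Algebra.Etale R E] {e : E} (he : IsIdempotentElem e) :
    Algebra.Etale R (E ⧸ Ideal.span {1 - e}) := by
  have := IsLocalization.Away.quotient_of_isIdempotentElem he
  have : Algebra.Etale E (E ⧸ Ideal.span {1 - e}) := Algebra.Etale.of_isLocalizationAway e
  exact Algebra.Etale.comp R E _

end HenselianPair

/-! ### Sections, coprime factorizations and general idempotents -/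

namespace HenselianPair

open Polynomial TensorProduct

/-- If an idempotent `e` of an étale algebra `E` cuts out a point `τ` modulo `I`, and the
corresponding clopen piece of `E` is finite, then `τ` lifts to a section of `R → E`. -/
theorem exists_section_of_isIdempotentElem {R S E : Type*} [CommRing R] [CommRing S] [CommRing E]
    [Algebra R S] [Algebra R E] [Algebra.Etale R E] (hS : Function.Surjective (algebraMap R S))
    (hI : RingHom.ker (algebraMap R S) ≤ Ideal.jacobson ⊥) (τ : E →ₐ[R] S) {e : E}
    (he : IsIdempotentElem e) (hτe : τ e = 1) [Module.Finite R (E ⧸ Ideal.span {1 - e})]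
    (h : ∀ x, τ x = 0 → x * e ∈ (RingHom.ker (algebraMap R S)).map (algebraMap R E)) :
    ∃ s : E →ₐ[R] R, ∀ x, algebraMap R S (s x) = τ x := by
  have := etale_quotient_of_isIdempotentElem (R := R) he
  set I := RingHom.ker (algebraMap R S)
  let q : E →ₐ[R] E ⧸ Ideal.span {1 - e} := Ideal.Quotient.mkₐ R _
  have hqe : q e = 1 := by
    rw [← sub_eq_zero, ← map_one q, ← map_sub]
    change Ideal.Quotient.mk _ (e - 1) = 0
    rw [Ideal.Quotient.eq_zero_iff_mem, ← Ideal.neg_mem_iff, neg_sub]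
    exact Ideal.mem_span_singleton_self _
  have hqI : (I.map (algebraMap R E)).map q = I.map (algebraMap R (E ⧸ Ideal.span {1 - e})) := by
    have : (q : E →+* E ⧸ Ideal.span {1 - e}).comp (algebraMap R E) = algebraMap R _ :=
      q.comp_algebraMap
    rw [← this, ← Ideal.map_map]
    rfl
  let τ' : E ⧸ Ideal.span {1 - e} →ₐ[R] S := Ideal.Quotient.liftₐ _ τ (by
    change Ideal.span {1 - e} ≤ RingHom.ker τ
    rw [Ideal.span_singleton_le_iff_mem, RingHom.mem_ker, map_sub, map_one, hτe, sub_self])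
  have hτ' : ∀ x, τ' (q x) = τ x := fun x => rfl
  -- On the piece where `e = 1`, the hypothesis `h` says that the reduction modulo `I` is `S`; a
  -- finite étale algebra with trivial reduction is `R` itself.
  have hbij : Function.Bijective (algebraMap R (E ⧸ Ideal.span {1 - e})) := by
    refine algebraMap_bijective_of_etale hI (fun d => ?_) (fun c hc => ?_)
    · obtain ⟨x, rfl⟩ := Ideal.Quotient.mkₐ_surjective R _ d
      change ∃ c, q x - _ ∈ _
      obtain ⟨r, hr⟩ := hS (τ x)
      refine ⟨r, ?_⟩
      have h1 := Ideal.mem_map_of_mem q (h (x - algebraMap R E r) (by simp [hr]))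
      rw [hqI, map_mul, hqe, mul_one, map_sub, AlgHom.commutes] at h1
      exact h1
    · have h1 := Ideal.mem_map_of_mem τ' hc
      have h2 : (I.map (algebraMap R (E ⧸ Ideal.span {1 - e}))).map τ' = ⊥ := by
        change (I.map (algebraMap R (E ⧸ Ideal.span {1 - e}))).map (τ' : _ →+* S) = ⊥
        rw [Ideal.map_map, τ'.comp_algebraMap, Ideal.map_eq_bot_iff_le_ker]
      rw [h2, AlgHom.commutes] at h1
      exact h1
  let φ := AlgEquiv.ofBijective (Algebra.ofId R (E ⧸ Ideal.span {1 - e})) hbij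
  refine ⟨φ.symm.toAlgHom.comp q, fun x => ?_⟩
  have h1 : algebraMap R (E ⧸ Ideal.span {1 - e}) (φ.symm (q x)) = q x := φ.apply_symm_apply (q x)
  change algebraMap R S (φ.symm (q x)) = τ x
  rw [← hτ', ← h1, AlgHom.commutes, h1]

/-- Sections of étale localizations of finite algebras lift along Henselian pairs. -/
theorem exists_section_of_isLocalization {R S B E : Type*} [CommRing R] [CommRing S]
    [CommRing B] [CommRing E] [Algebra R S] [Algebra R B] [Algebra R E] [Algebra B E]
    [IsScalarTower R B E] [Module.Finite R B] (Δ : B) [IsLocalization.Away Δ E]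
    [Algebra.Etale R E] (hS : Function.Surjective (algebraMap R S))
    [HenselianRing R (RingHom.ker (algebraMap R S))] (τ : E →ₐ[R] S) :
    ∃ s : E →ₐ[R] R, ∀ x, algebraMap R S (s x) = τ x := by
  set I := RingHom.ker (algebraMap R S) with hI
  obtain ⟨e, he1, he⟩ := exists_separating_element_of_isLocalization Δ hS τ
  have hone : ∀ r : R, τ (algebraMap B E (algebraMap R B r)) = algebraMap R S r := fun r => by
    rw [← IsScalarTower.algebraMap_apply, AlgHom.commutes]
  have hτI : ∀ x ∈ I.map (algebraMap R B), τ (algebraMap B E x) = 0 := by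
    have : I.map (algebraMap R B) ≤ RingHom.ker ((τ : E →+* S).comp (algebraMap B E)) := by
      rw [Ideal.map_le_iff_le_comap]
      intro r hr
      rw [Ideal.mem_comap, RingHom.mem_ker]
      exact (hone r).trans hr
    exact fun x hx => this hx
  obtain ⟨e', hidem, hee'⟩ := exists_isIdempotentElem_of_rank_one I e
    (by
      have := he (e - 1) (by simp [he1])
      rwa [sub_mul, one_mul] at this)
    (fun b => by
      obtain ⟨r, hr⟩ := hS (τ (algebraMap B E b))
      refine ⟨r, ?_⟩
      have := he (b - algebraMap R B r) (by rw [map_sub, map_sub, hone, hr, sub_self])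
      rwa [sub_mul, mul_comm b, mul_comm _ e] at this)
  have he' : ∀ b, τ (algebraMap B E b) = 0 → b * e' ∈ I.map (algebraMap R B) := by
    intro b hb
    have : b * e' = b * e + b * (e' - e) := by ring
    rw [this]
    exact Ideal.add_mem _ (he b hb) (Ideal.mul_mem_left _ _ hee')
  have hτe' : τ (algebraMap B E e') = 1 := by
    have := hτI _ hee'
    rwa [map_sub, map_sub, he1, sub_eq_zero] at this
  have hΔ : IsUnit (algebraMap B E Δ) := IsLocalization.Away.algebraMap_isUnit Δ
  obtain ⟨c, hc⟩ := (hΔ.map τ).exists_right_inv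
  obtain ⟨c, rfl⟩ := hS c
  -- Here `c` lifts the inverse of `τ Δ`, so `Δ c - 1` is killed by `τ` and hence lies in `IB` after
  -- multiplication by `e'`.
  have hfin : Module.Finite R (E ⧸ Ideal.span {1 - algebraMap B E e'}) := by
    refine finite_quotient_of_isIdempotentElem (I := I) HenselianRing.jac
      (IsScalarTower.toAlgHom R B E) e' (Δ * algebraMap R B c) (he' _ ?_) (fun x => ?_)
    · rw [map_sub, map_sub, map_mul, map_mul, hone, hc, map_one, map_one, sub_self]
    · obtain ⟨n, b, hb⟩ := IsLocalization.Away.surj Δ x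
      refine ⟨n, b * algebraMap R B c ^ n, ?_⟩
      simp only [IsScalarTower.coe_toAlgHom', map_mul, map_pow, ← hb]
      ring
  refine exists_section_of_isIdempotentElem hS HenselianRing.jac τ
    (hidem.map (algebraMap B E)) hτe' (fun x hx => ?_)
  obtain ⟨n, b, hb⟩ := IsLocalization.Away.surj Δ x
  have h1 : algebraMap B E b * algebraMap B E e' ∈ I.map (algebraMap R E) := by
    have := Ideal.mem_map_of_mem (algebraMap B E) (he' b (by rw [← hb, map_mul, hx, zero_mul]))
    rwa [Ideal.map_map, ← IsScalarTower.algebraMap_eq, map_mul] at this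
  rw [← hb, mul_right_comm, mul_comm] at h1
  exact (Ideal.unit_mul_mem_iff_mem _ (hΔ.pow n)).mp h1

/-- Coprime factorizations of monic polynomials lift along Henselian pairs. -/
theorem exists_coprime_factorization {R S : Type*} [CommRing R] [CommRing S] [Algebra R S]
    (hS : Function.Surjective (algebraMap R S)) [HenselianRing R (RingHom.ker (algebraMap R S))]
    {n m k : ℕ} (hn : n = m + k) (f : MonicDegreeEq R n) (g₀ : MonicDegreeEq S m)
    (h₀ : MonicDegreeEq S k) (hfac : g₀.1 * h₀.1 = f.1.map (algebraMap R S))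
    (hcop : IsCoprime g₀.1 h₀.1) :
    ∃ g h : R[X], g * h = f.1 ∧ IsCoprime g h ∧ g.map (algebraMap R S) = g₀.1 ∧
      h.map (algebraMap R S) = h₀.1 := by
  -- The given factorization over `S` is an `S`-point of the universal ring, which is étale and is
  -- the finite universal factorization ring with a Jacobian inverted. A section lifting this point
  -- is a factorization over `R`.
  let τ := (UniversalCoprimeFactorizationRing.homEquiv S m k hn f).symm ⟨(g₀, h₀), hfac, hcop⟩
  obtain ⟨s, hs⟩ := exists_section_of_isLocalization
    (UniversalFactorizationRing.presentation m k hn f).jacobian hS τ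
  have hτ : (Algebra.ofId R S).comp s = τ := AlgHom.ext hs
  let y := UniversalCoprimeFactorizationRing.homEquiv R m k hn f s
  have hy := (UniversalCoprimeFactorizationRing.homEquiv S m k hn f).apply_symm_apply
    ⟨(g₀, h₀), hfac, hcop⟩
  change UniversalCoprimeFactorizationRing.homEquiv S m k hn f τ = _ at hy
  rw [← hτ] at hy
  refine ⟨y.1.1.1, y.1.2.1, ?_, y.2.2, ?_, ?_⟩
  · simpa using y.2.1
  · have h1 := UniversalCoprimeFactorizationRing.homEquiv_comp_fst R m k hn f s (Algebra.ofId R S)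
    rw [hy] at h1
    exact (congrArg Subtype.val h1).symm
  · have h1 := UniversalCoprimeFactorizationRing.homEquiv_comp_snd R m k hn f s (Algebra.ofId R S)
    rw [hy] at h1
    exact (congrArg Subtype.val h1).symm

/-- Idempotents of finite algebras lift along Henselian pairs. -/
theorem exists_isIdempotentElem_sub_mem {R B : Type*} [CommRing R] [CommRing B] [Algebra R B]
    [Module.Finite R B] (I : Ideal R) [HenselianRing R I] (b : B)
    (hb : b * b - b ∈ I.map (algebraMap R B)) :
    ∃ e : B, IsIdempotentElem e ∧ e - b ∈ I.map (algebraMap R B) := by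
  cases subsingleton_or_nontrivial (R ⧸ I) with
  | inl hsub =>
    have : I = ⊤ := Ideal.Quotient.subsingleton_iff.mp hsub
    subst this
    exact ⟨0, IsIdempotentElem.zero, by rw [Ideal.map_top]; trivial⟩
  | inr hnt =>
  have hnt' : Nontrivial R := (Ideal.Quotient.mk_surjective (I := I)).nontrivial
  -- Multiplication by `b² - b` sends `B` into `IB`, so Cayley–Hamilton gives a monic annihilating
  -- polynomial congruent to a power of `X` modulo `I`.
  obtain ⟨q, hqm, -, hqI, hq0⟩ :=
    LinearMap.exists_monic_and_natDegree_eq_and_coeff_mem_pow_and_aeval_eq_zero R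
      (Algebra.lmul R B (b * b - b)) I (by
        rw [Ideal.smul_top_eq_map]
        rintro _ ⟨x, rfl⟩
        exact Ideal.mul_mem_right _ _ hb)
  have hq0' : aeval (b * b - b) q = 0 := by
    have h1 := Polynomial.aeval_algHom_apply (Algebra.lmul R B) (b * b - b) q
    have h2 : Algebra.lmul R B (aeval (b * b - b) q) 1 = 0 := by
      rw [← h1, hq0, LinearMap.zero_apply]
    simpa using h2
  set N := q.natDegree with hN
  have hker : RingHom.ker (algebraMap R (R ⧸ I)) = I := Ideal.mk_ker
  have : HenselianRing R (RingHom.ker (algebraMap R (R ⧸ I))) := by rwa [hker]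
  let π := algebraMap R (R ⧸ I)
  have hqbar : q.map π = X ^ N := by
    ext i
    rw [coeff_map, coeff_X_pow]
    rcases lt_trichotomy i N with hi | hi | hi
    · rw [if_neg hi.ne]
      refine Ideal.Quotient.eq_zero_iff_mem.mpr (Ideal.pow_le_self ?_ (hqI i))
      omega
    · rw [if_pos hi, hi, hN, hqm.coeff_natDegree, map_one]
    · rw [if_neg hi.ne', coeff_eq_zero_of_natDegree_lt hi, map_zero]
  -- multiply by one more factor so that the exponents below are positive
  let f : R[X] := (q * X).comp (X * (X - 1))
  have hfac0 : f = q.comp (X * (X - 1)) * (X * (X - 1)) := by simp [f]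
  have hX1 : (X * (X - 1) : R[X]).Monic := monic_X.mul (by simpa using monic_X_sub_C (1 : R))
  have hX1' : (X - 1 : (R ⧸ I)[X]).Monic := by simpa using monic_X_sub_C (1 : R ⧸ I)
  have hdeg : (X * (X - 1) : R[X]).natDegree = 2 := by
    rw [monic_X.natDegree_mul (by simpa using monic_X_sub_C (1 : R)), natDegree_X,
      show (X - 1 : R[X]) = X - C 1 by simp, natDegree_X_sub_C]
  have hfmon : f.Monic := (hqm.mul monic_X).comp hX1 (by rw [hdeg]; norm_num)
  have hfmap : f.map π = X ^ (N + 1) * (X - 1) ^ (N + 1) := by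
    simp only [f, Polynomial.map_comp, Polynomial.map_mul, hqbar, Polynomial.map_sub, map_X,
      Polynomial.map_one, mul_comp, pow_comp, X_comp, mul_pow]
    ring
  have hfdeg : f.natDegree = (N + 1) + (N + 1) := by
    rw [← hfmon.natDegree_map π, hfmap, (monic_X.pow _).natDegree_mul (hX1'.pow _),
      natDegree_X_pow, hX1'.natDegree_pow, show (X - 1 : (R ⧸ I)[X]) = X - C 1 by simp,
      natDegree_X_sub_C, mul_one]
  have hfb : aeval b f = 0 := by
    rw [hfac0, map_mul, aeval_comp]
    have : aeval b (X * (X - 1) : R[X]) = b * b - b := by simp; ring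
    rw [this, hq0', zero_mul]
  obtain ⟨g, h, hgh, ⟨u, v, huv⟩, hg, hh⟩ := exists_coprime_factorization (S := R ⧸ I)
    Ideal.Quotient.mk_surjective rfl
    (.mk f hfmon hfdeg) (.mk (X ^ (N + 1)) (monic_X.pow _) (natDegree_X_pow _))
    (.mk ((X - 1) ^ (N + 1)) (hX1'.pow _) (by
      rw [hX1'.natDegree_pow, show (X - 1 : (R ⧸ I)[X]) = X - C 1 by simp, natDegree_X_sub_C,
        mul_one]))
    (by exact hfmap.symm)
    (by
      refine IsCoprime.pow ⟨1, -1, ?_⟩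
      ring)
  change g * h = f at hgh
  change g.map π = X ^ (N + 1) at hg
  change h.map π = (X - 1) ^ (N + 1) at hh
  have hgh0 : aeval b g * aeval b h = 0 := by rw [← map_mul, hgh, hfb]
  have huv1 : aeval b u * aeval b g + aeval b v * aeval b h = 1 := by
    rw [← map_mul, ← map_mul, ← map_add, huv, map_one]
  -- The two summands of `u(b) g(b) + v(b) h(b) = 1` have product zero, so each is idempotent.
  -- Modulo `I`, `g(b) = b` and `b h(b) = 0`; multiplying the relation by `b` gives `u(b) b = b`.
  refine ⟨aeval b u * aeval b g, ?_, ?_⟩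
  · rw [IsIdempotentElem]
    linear_combination (aeval b u * aeval b g) * huv1 - aeval b u * aeval b v * hgh0
  · let Q := Ideal.Quotient.mk (I.map (algebraMap R B))
    have hQ : ∀ p p' : R[X], p.map π = p'.map π → Q (aeval b p) = Q (aeval b p') := by
      intro p p' hpp
      rw [← sub_eq_zero, ← map_sub, ← map_sub, aeval_eq_sum_range, map_sum]
      refine Finset.sum_eq_zero fun i _ => ?_
      rw [Algebra.smul_def, map_mul]
      have h1 : (p - p').coeff i ∈ I := by
        rw [← Ideal.Quotient.eq_zero_iff_mem]
        change π _ = 0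
        rw [← coeff_map, Polynomial.map_sub, hpp, sub_self, coeff_zero]
      have h2 : Q (algebraMap R B ((p - p').coeff i)) = 0 :=
        Ideal.Quotient.eq_zero_iff_mem.mpr (Ideal.mem_map_of_mem _ h1)
      rw [h2, zero_mul]
    have hQb : Q b * Q b = Q b := by
      rw [← sub_eq_zero, ← map_mul, ← map_sub]
      exact Ideal.Quotient.eq_zero_iff_mem.mpr hb
    have hQg : Q (aeval b g) = Q b := by
      rw [hQ g (X ^ (N + 1)) (by rw [hg]; simp), map_pow, aeval_X, map_pow]
      exact IsIdempotentElem.pow_succ_eq N hQb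
    have hQh : Q b * Q (aeval b h) = 0 := by
      rw [hQ h ((X - 1) ^ (N + 1)) (by rw [hh]; simp), pow_succ']
      simp only [map_mul, map_pow, map_sub, aeval_X, map_one]
      linear_combination (Q b - 1) ^ N * hQb
    have h3 := congrArg Q huv1
    simp only [map_add, map_mul, map_one, hQg] at h3
    rw [← Ideal.Quotient.eq_zero_iff_mem]
    change Q _ = 0
    rw [map_sub, map_mul, hQg]
    linear_combination Q b * h3 - Q (aeval b v) * hQh - Q (aeval b u) * hQb

end HenselianPair

/-! ### Reduction of algebras and lifting of morphisms -/

namespace HenselianPair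

open TensorProduct

section

variable {R S : Type*} [CommRing R] [CommRing S] [Algebra R S]

theorem includeRight_surjective (hS : Function.Surjective (algebraMap R S)) (C : Type*) [CommRing C]
    [Algebra R C] :
    Function.Surjective (Algebra.TensorProduct.includeRight : C →ₐ[R] S ⊗[R] C) := by
  intro x
  induction x with
  | zero => exact ⟨0, map_zero _⟩
  | add x y hx hy =>
    obtain ⟨a, rfl⟩ := hx
    obtain ⟨b, rfl⟩ := hy
    exact ⟨a + b, map_add _ _ _⟩
  | tmul s c =>
    obtain ⟨r, rfl⟩ := hS s
    refine ⟨r • c, ?_⟩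
    rw [Algebra.TensorProduct.includeRight_apply, ← TensorProduct.smul_tmul,
      Algebra.algebraMap_eq_smul_one]

/-- This is `S ⊗ C = C/IC` in terms of elements: `S` maps to `C/IC`, and the induced map from the
tensor product detects membership in `IC`. -/
theorem includeRight_eq_zero_iff (hS : Function.Surjective (algebraMap R S)) {C : Type*}
    [CommRing C] [Algebra R C] (c : C) :
    (1 : S) ⊗ₜ[R] c = 0 ↔ c ∈ (RingHom.ker (algebraMap R S)).map (algebraMap R C) := by
  set K := (RingHom.ker (algebraMap R S)).map (algebraMap R C)
  constructor
  · intro h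
    let θ : S →ₐ[R] C ⧸ K := AlgHom.liftOfSurjective (Algebra.ofId R S) hS (Algebra.ofId R _) (by
      intro r hr
      rw [RingHom.mem_ker] at hr ⊢
      change algebraMap R (C ⧸ K) r = 0
      rw [IsScalarTower.algebraMap_apply R C (C ⧸ K)]
      exact Ideal.Quotient.eq_zero_iff_mem.mpr (Ideal.mem_map_of_mem _ hr))
    have := congrArg (Algebra.TensorProduct.productMap θ (Ideal.Quotient.mkₐ R K)) h
    rw [Algebra.TensorProduct.productMap_apply_tmul, map_one, one_mul, map_zero] at this
    exact Ideal.Quotient.eq_zero_iff_mem.mp this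
  · intro h
    have : K ≤ RingHom.ker (Algebra.TensorProduct.includeRight : C →ₐ[R] S ⊗[R] C) := by
      rw [Ideal.map_le_iff_le_comap]
      intro r hr
      rw [RingHom.mem_ker] at hr
      rw [Ideal.mem_comap, RingHom.mem_ker, AlgHom.commutes, IsScalarTower.algebraMap_apply R S, hr,
        map_zero]
    exact this h

/-- Two maps from a finite étale algebra that agree modulo an ideal in the Jacobson radical are
equal. -/
theorem algHom_ext_of_comp_eq {B C C' : Type*} [CommRing B] [CommRing C] [CommRing C']
    [Algebra R B] [Algebra R C] [Algebra R C'] [Algebra.FormallyUnramified R B]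
    [Algebra.EssFiniteType R B] (π : C →ₐ[R] C') (hπ : RingHom.ker π ≤ Ideal.jacobson ⊥)
    {f g : B →ₐ[R] C} (h : π.comp f = π.comp g) : f = g := by
  let P := Algebra.TensorProduct.productMap f g
  let el := Algebra.FormallyUnramified.elem R B
  have h1 : π.comp P = (π.comp f).comp (Algebra.TensorProduct.lmul' R) := by
    ext x
    · simp [P]
    · simpa [P] using (DFunLike.congr_fun h x).symm
  have h2 : π (P el) = 1 := by
    have := DFunLike.congr_fun h1 el
    simp only [AlgHom.comp_apply, el, Algebra.FormallyUnramified.lmul_elem, map_one] at this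
    exact this
  -- `P el` conjugates nothing but compares: it satisfies `g x * P el = f x * P el`, so being a unit
  -- it forces `f = g`.
  have hu : IsUnit (P el) := by
    refine isUnit_of_sub_one_mem hπ ?_
    rw [RingHom.mem_ker, map_sub, h2, map_one, sub_self]
  ext x
  have h3 := congrArg P (Algebra.FormallyUnramified.one_tmul_mul_elem (R := R) x)
  simp only [map_mul, P, Algebra.TensorProduct.productMap_apply_tmul, map_one, one_mul,
    mul_one] at h3
  exact (hu.mul_right_cancel h3).symm

/-- Maps of finite étale algebras lift along Henselian pairs. -/
theorem exists_algHom_lift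
    [HenselianRing R (RingHom.ker (algebraMap R S))] {B C C' : Type*} [CommRing B] [CommRing C]
    [CommRing C'] [Algebra R B] [Algebra R C] [Algebra R C'] [Module.Finite R B] [Module.Finite R C]
    [Algebra.Etale R B] (π : C →ₐ[R] C') (hπ : Function.Surjective π)
    (hker : RingHom.ker π = (RingHom.ker (algebraMap R S)).map (algebraMap R C))
    (σ : B →ₐ[R] C') : ∃ f : B →ₐ[R] C, π.comp f = σ := by
  set I := RingHom.ker (algebraMap R S)
  let _ : Algebra C C' := π.toAlgebra
  have : IsScalarTower R C C' := IsScalarTower.of_algebraMap_eq fun r => (π.commutes r).symm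
  have hkerC : RingHom.ker (algebraMap C C') = I.map (algebraMap R C) := hker
  have hmap : (I.map (algebraMap R C)).map (algebraMap C (C ⊗[R] B)) =
      I.map (algebraMap R (C ⊗[R] B)) := by
    rw [Ideal.map_map, ← IsScalarTower.algebraMap_eq]
  let τ : C ⊗[R] B →ₐ[C] C' :=
    Algebra.TensorProduct.lift (Algebra.ofId C C') σ (fun _ _ => Commute.all _ _)
  obtain ⟨ε, hε1, hε⟩ := exists_separating_element (R := C) hπ τ
  rw [hkerC, hmap] at hε
  have hfin : Module.Finite R (C ⊗[R] B) := Module.Finite.trans C _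
  have hjac : (RingHom.ker (algebraMap C C')) ≤ Ideal.jacobson ⊥ := by
    rw [hkerC]
    exact map_le_jacobson_bot_of_isIntegral HenselianRing.jac
  have hτI : ∀ x ∈ I.map (algebraMap R (C ⊗[R] B)), τ x = 0 := by
    have : I.map (algebraMap R (C ⊗[R] B)) ≤ RingHom.ker τ := by
      rw [← hmap, Ideal.map_le_iff_le_comap, ← hkerC]
      intro c hc
      rw [Ideal.mem_comap, RingHom.mem_ker, AlgHom.commutes]
      exact hc
    exact fun x hx => this hx
  -- `C ⊗ B` is finite over `R`, so the idempotent lifts along `(R, I)` itself and `(C, IC)` need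
  -- not be shown Henselian.
  obtain ⟨e, he, hee⟩ := exists_isIdempotentElem_sub_mem I ε (by
    have := hε (ε - 1) (by simp [hε1])
    rwa [sub_mul, one_mul] at this)
  have hτe : τ e = 1 := by
    have := hτI _ hee
    rwa [map_sub, hε1, sub_eq_zero] at this
  obtain ⟨s, hs⟩ := exists_section_of_isIdempotentElem (R := C) hπ hjac τ he hτe (fun x hx => by
    rw [hkerC, hmap]
    have : x * e = x * ε + x * (e - ε) := by ring
    rw [this]
    exact Ideal.add_mem _ (hε x hx) (Ideal.mul_mem_left _ _ hee))
  refine ⟨(s.restrictScalars R).comp Algebra.TensorProduct.includeRight, ?_⟩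
  ext b
  have := hs (1 ⊗ₜ b)
  rw [Algebra.TensorProduct.lift_tmul, map_one, one_mul] at this
  exact this

end

/-! ### Limits along nil kernels and the small tilt -/

/-- The limit of a tower of surjective ring maps with nil kernels is Henselian along the kernel of
the projection to the bottom of the tower. -/
theorem henselianRing_of_limit {G : ℕ → Type*} [∀ m, CommRing (G m)] (F : ∀ m, G (m + 1) →+* G m)
    (hF : ∀ m, Function.Surjective (F m)) (hnil : ∀ m x, F m x = 0 → IsNilpotent x)
    (L : Subring (∀ m, G m)) (hL : ∀ a, a ∈ L ↔ ∀ m, F m (a (m + 1)) = a m) :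
    HenselianRing L (RingHom.ker ((Pi.evalRingHom G 0).comp L.subtype)) := by
  have hunit : ∀ m x, IsUnit (F m x) → IsUnit x := by
    intro m x hx
    obtain ⟨v, hv⟩ := hx.exists_right_inv
    obtain ⟨w, rfl⟩ := hF m v
    have h1 : IsNilpotent (x * w - 1) := hnil m _ (by rw [map_sub, map_mul, hv, map_one, sub_self])
    have h2 := h1.isUnit_add_one
    rw [sub_add_cancel] at h2
    exact isUnit_of_mul_isUnit_left h2
  constructor
  · intro x hx
    rw [RingHom.mem_ker] at hx
    rw [Ideal.mem_jacobson_bot]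
    intro y
    set z := x * y + 1 with hz
    have hz' := (hL _).mp z.2
    have hz0 : (z : ∀ m, G m) 0 = 1 := by
      change (x : ∀ m, G m) 0 * (y : ∀ m, G m) 0 + 1 = 1
      have : (x : ∀ m, G m) 0 = 0 := hx
      rw [this, zero_mul, zero_add]
    have hu : ∀ m, IsUnit ((z : ∀ m, G m) m) := by
      intro m
      induction m with
      | zero => rw [hz0]; exact isUnit_one
      | succ m ih => exact hunit m _ (by rw [hz' m]; exact ih)
    choose w hw using fun m => (hu m).exists_right_inv
    have hwL : w ∈ L := by
      rw [hL]
      intro m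
      refine (hu m).mul_left_cancel ?_
      rw [hw, ← hz' m, ← map_mul, hw, map_one]
    exact IsUnit.of_mul_eq_one ⟨w, hwL⟩ (Subtype.ext (funext hw))
  · intro f _ a₀ h0 h1
    let ev : ∀ m, L →+* G m := fun m => (Pi.evalRingHom G m).comp L.subtype
    have hev : ∀ m (a : L), F m (ev (m + 1) a) = ev m a := fun m a => (hL _).mp a.2 m
    have hFf : ∀ (g : Polynomial L) m x,
        F m ((g.map (ev (m + 1))).eval x) = (g.map (ev m)).eval (F m x) := by
      intro g m x
      have : ev m = (F m).comp (ev (m + 1)) := RingHom.ext fun a => (hev m a).symm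
      rw [this, ← Polynomial.map_map (ev (m + 1)) (F m) g, Polynomial.eval_map (F m),
        Polynomial.eval₂_at_apply]
    have hevf : ∀ (g : Polynomial L) m a, ev m (g.eval a) = (g.map (ev m)).eval (ev m a) := by
      intro g m a
      rw [Polynomial.eval_map, Polynomial.eval₂_at_apply]
    let P : ∀ m, G m → Prop := fun m b =>
      (f.map (ev m)).eval b = 0 ∧ IsUnit ((f.derivative.map (ev m)).eval b)
    have hstart : P 0 (ev 0 a₀) := by
      refine ⟨by rw [← hevf]; exact h0, ?_⟩
      rw [← hevf]
      exact h1.map (Ideal.Quotient.lift (RingHom.ker (ev 0)) (ev 0) (fun a ha => ha))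
    have hstep : ∀ m b, P m b → ∃ b', F m b' = b ∧ P (m + 1) b' := by
      rintro m b ⟨hb0, hb1⟩
      obtain ⟨y, rfl⟩ := hF m b
      have hy0 : IsNilpotent (Polynomial.aeval y (f.map (ev (m + 1)))) := by
        rw [Polynomial.coe_aeval_eq_eval]
        exact hnil m _ (by rw [hFf, hb0])
      have hy1 : IsUnit (Polynomial.aeval y (f.map (ev (m + 1))).derivative) := by
        rw [Polynomial.coe_aeval_eq_eval, Polynomial.derivative_map]
        exact hunit m _ (by rw [hFf]; exact hb1)
      obtain ⟨r, ⟨hr1, hr0⟩, -⟩ := Polynomial.existsUnique_nilpotent_sub_and_aeval_eq_zero hy0 hy1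
      rw [Polynomial.coe_aeval_eq_eval] at hr0
      -- The lifted root `r` is only known to differ from `y` by a nilpotent, not by an element of
      -- `ker (F m)`. Uniqueness of the nearby simple root one level below identifies the images.
      have hFr : F m r = F m y := by
        refine (Polynomial.existsUnique_nilpotent_sub_and_aeval_eq_zero (x := F m y)
          (P := f.map (ev m)) ?_ ?_).unique ⟨?_, ?_⟩ ⟨?_, ?_⟩
        · rw [Polynomial.coe_aeval_eq_eval, hb0]; exact IsNilpotent.zero
        · rw [Polynomial.coe_aeval_eq_eval, Polynomial.derivative_map]; exact hb1
        · rw [← map_sub]; exact hr1.map (F m)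
        · rw [Polynomial.coe_aeval_eq_eval, ← hFf, hr0, map_zero]
        · rw [sub_self]; exact IsNilpotent.zero
        · rw [Polynomial.coe_aeval_eq_eval, hb0]
      refine ⟨r, hFr, hr0, hunit m _ ?_⟩
      rw [hFf, hFr]; exact hb1
    choose! next hnext hPnext using hstep
    let b : ∀ m, G m := fun m => Nat.rec (motive := G) (ev 0 a₀) next m
    have hPb : ∀ m, P m (b m) := by
      intro m
      induction m with
      | zero => exact hstart
      | succ m ih => exact hPnext m _ ih
    have hbL : b ∈ L := (hL b).mpr fun m => hnext m _ (hPb m)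
    refine ⟨⟨b, hbL⟩, ?_, ?_⟩
    · rw [Polynomial.IsRoot]
      refine Subtype.ext (funext fun m => ?_)
      change ev m _ = 0
      rw [hevf]
      exact (hPb m).1
    · rw [RingHom.mem_ker, map_sub, sub_eq_zero]
      rfl

/-- The kernels of the Frobenius projections are nil: applying `tbar` to `Fᵢ x = 0` gives `x ^ p =
0`. -/
theorem smallTilt_henselianRing {p : ℕ} [hp : Fact p.Prime] {R : ℕ → Type*} [∀ i, CommRing (R i)]
    {t : ∀ i, R i →+* R (i + 1)} {I₀ : Ideal (R 0)} (h : IsPerfectoidTower t I₀ p) (i : ℕ) :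
    HenselianRing (smallTilt h i) (RingHom.ker (smallTiltProj h i)) := by
  refine henselianRing_of_limit (fun m => frobProj h.toIsPurelyInseparable (i + m))
    (fun m => h.frobProj_surjective (i + m)) (fun m x hx => ⟨p, ?_⟩) (smallTilt h i)
    (fun a => Iff.rfl)
  exact (tbar_frobProj h.toIsPurelyInseparable (i + m) x).symm.trans
    ((congrArg _ hx).trans (map_zero _))

theorem smallTiltProj_surjective {p : ℕ} [Fact p.Prime] {R : ℕ → Type*} [∀ i, CommRing (R i)]
    {t : ∀ i, R i →+* R (i + 1)} {I₀ : Ideal (R 0)} (h : IsPerfectoidTower t I₀ p) (i : ℕ) :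
    Function.Surjective (smallTiltProj h i) := by
  intro x
  choose g hg using fun m => h.frobProj_surjective (i + m)
  exact ⟨⟨fun m => Nat.rec (motive := fun m => LayerQuot t I₀ (i + m)) x (fun m y => g m y) m,
    fun m => hg m _⟩, rfl⟩

end HenselianPair

/-! ### Lifting étale algebras and splitting off a finite piece -/

namespace HenselianPair

open TensorProduct

/-- Étale algebras lift along surjective ring maps. -/
theorem exists_etale_lift {R S T : Type u} [CommRing R] [CommRing S] [CommRing T] [Algebra R S]
    [Algebra S T] [Algebra R T] [IsScalarTower R S T] [Algebra.Etale S T]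
    (hS : Function.Surjective (algebraMap R S)) :
    ∃ (E : Type u) (_ : CommRing E) (_ : Algebra R E) (_ : Algebra.Etale R E) (φ : E →ₐ[R] T),
      Function.Surjective φ ∧
      RingHom.ker φ ≤ (RingHom.ker (algebraMap R S)).map (algebraMap R E) := by
  classical
  set I := RingHom.ker (algebraMap R S) with hI
  obtain ⟨ι, σ, hσ, hι, P, hP⟩ :=
    (Algebra.Etale.iff_isStandardSmoothOfRelativeDimension_zero.mp ‹Algebra.Etale S T›).out
  cases nonempty_fintype σ
  let π : MvPolynomial ι R →+* MvPolynomial ι S := MvPolynomial.map (algebraMap R S)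
  have hπ : Function.Surjective π := MvPolynomial.map_surjective _ hS
  -- Arbitrary lifts of the defining equations suffice: the Jacobian of the lifted system maps to
  -- the old one, a unit of `T`, so inverting it makes the algebra étale and keeps the map to `T`.
  choose F hF using fun s => hπ (P.relation s)
  let A := MvPolynomial ι R ⧸ Ideal.span (Set.range F)
  let N : Algebra.PreSubmersivePresentation R A ι σ :=
    Algebra.PreSubmersivePresentation.naive P.map P.map_inj
  let ψ : MvPolynomial ι R →ₐ[R] T := MvPolynomial.aeval P.val
  have hψ : ∀ f, ψ f = MvPolynomial.aeval P.val (π f) := fun f =>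
    (MvPolynomial.aeval_map_algebraMap S P.val f).symm
  have hψF : ∀ f ∈ Ideal.span (Set.range F), ψ f = 0 := by
    have : Ideal.span (Set.range F) ≤ RingHom.ker ψ := by
      rw [Ideal.span_le]
      rintro _ ⟨s, rfl⟩
      change ψ (F s) = 0
      rw [hψ, hF]
      exact P.aeval_val_relation s
    exact fun f hf => this hf
  let φ₀ : A →ₐ[R] T := Ideal.Quotient.liftₐ _ ψ hψF
  have hφ₀ : ∀ f, φ₀ (Ideal.Quotient.mk _ f) = ψ f := fun f => rfl
  have hjac : φ₀ N.jacobian = P.jacobian := by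
    rw [Algebra.PreSubmersivePresentation.jacobian_eq_jacobiMatrix_det,
      Algebra.PreSubmersivePresentation.jacobian_eq_jacobiMatrix_det]
    have h1 : π.mapMatrix N.jacobiMatrix = P.jacobiMatrix := by
      ext1 i j
      rw [RingHom.mapMatrix_apply, Matrix.map_apply,
        Algebra.PreSubmersivePresentation.jacobiMatrix_naive,
        Algebra.PreSubmersivePresentation.jacobiMatrix_apply, ← hF, MvPolynomial.pderiv_map]
    rw [← h1, ← RingHom.map_det, P.algebraMap_apply, N.algebraMap_apply]
    have h2 : φ₀.comp (MvPolynomial.aeval N.val) = ψ := by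
      ext i
      simp only [AlgHom.comp_apply, MvPolynomial.aeval_X]
      rfl
    exact (DFunLike.congr_fun h2 _).trans (hψ _)
  let E := Localization.Away N.jacobian
  have hΔ : IsUnit (algebraMap A E N.jacobian) := IsLocalization.Away.algebraMap_isUnit _
  have het : Algebra.Etale R E := by
    let Q : Algebra.SubmersivePresentation R E _ _ :=
      { toPreSubmersivePresentation := .comp (.localizationAway E N.jacobian) N,
        jacobian_isUnit := by simpa [Algebra.smul_def, -isUnit_map_iff] using hΔ }
    have : Algebra.IsStandardSmoothOfRelativeDimension 0 R E :=
      ⟨_, _, _, inferInstance, Q, by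
        simp only [Algebra.PreSubmersivePresentation.dimension_comp_eq_dimension_add_dimension, Q]
        have h1 : N.dimension = P.dimension := rfl
        rw [h1, hP]
        simp [Algebra.Presentation.dimension]⟩
    infer_instance
  have hJ : IsUnit (φ₀ N.jacobian) := by
    rw [hjac]
    exact P.jacobian_isUnit
  let φ : E →ₐ[R] T := IsLocalization.Away.liftAlgHom (f := φ₀) N.jacobian hJ
  have hφ (a : A) : φ (algebraMap A E a) = φ₀ a :=
    IsLocalization.Away.lift_eq (g := (φ₀ : A →+* T)) N.jacobian hJ a
  refine ⟨E, inferInstance, inferInstance, het, φ, fun x => ?_, fun x hx => ?_⟩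
  · obtain ⟨f, hf⟩ := P.aeval_val_surjective x
    obtain ⟨f, rfl⟩ := hπ f
    exact ⟨algebraMap A E (Ideal.Quotient.mk _ f), by rw [hφ, hφ₀, hψ, hf]⟩
  · obtain ⟨n, a, ha⟩ := IsLocalization.Away.surj N.jacobian x
    obtain ⟨f, rfl⟩ := Ideal.Quotient.mk_surjective a
    have h1 : ψ f = 0 := by
      rw [← hφ₀, ← hφ, ← ha, map_mul, RingHom.mem_ker.mp hx, zero_mul]
    rw [hψ] at h1
    have h2 : π f ∈ Ideal.span (Set.range P.relation) := by
      rw [P.span_range_relation_eq_ker, P.ker_eq_ker_aeval_val]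
      exact h1
    have h3 : Ideal.span (Set.range P.relation) = (Ideal.span (Set.range F)).map π := by
      rw [Ideal.map_span, ← Set.range_comp]
      exact congrArg _ (congrArg _ (funext fun s => (hF s).symm))
    rw [h3, Ideal.mem_map_iff_of_surjective π hπ] at h2
    obtain ⟨g, hg, hgf⟩ := h2
    have h4 : f - g ∈ I.map (algebraMap R (MvPolynomial ι R)) := by
      have : f - g ∈ RingHom.ker π := by rw [RingHom.mem_ker, map_sub, hgf, sub_self]
      rwa [MvPolynomial.ker_map] at this
    have h5 : algebraMap A E (Ideal.Quotient.mk _ f) ∈ I.map (algebraMap R E) := by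
      have h6 : (Ideal.Quotient.mk (Ideal.span (Set.range F)) f) =
          Ideal.Quotient.mk (Ideal.span (Set.range F)) (f - g) := by
        rw [map_sub, Ideal.Quotient.eq_zero_iff_mem.mpr hg, sub_zero]
      rw [h6]
      have h7 := Ideal.mem_map_of_mem (algebraMap A E)
        (Ideal.mem_map_of_mem (algebraMap (MvPolynomial ι R) A) h4)
      rwa [Ideal.map_map, Ideal.map_map, ← IsScalarTower.algebraMap_eq,
        ← IsScalarTower.algebraMap_eq] at h7
    rw [← ha, mul_comm] at h5
    exact (Ideal.unit_mul_mem_iff_mem _ (hΔ.pow n)).mp h5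

theorem exists_fin_sum_of_mem_map {R E : Type*} [CommRing R] [CommRing E] [Algebra R E]
    {I : Ideal R} {x : E} (hx : x ∈ I.map (algebraMap R E)) :
    ∃ (k : ℕ) (a : Fin k → R) (y : Fin k → E), (∀ l, a l ∈ I) ∧
      ∑ l, algebraMap R E (a l) * y l = x := by
  induction hx using Submodule.span_induction with
  | mem x hx =>
    obtain ⟨r, hr, rfl⟩ := hx
    exact ⟨1, fun _ => r, fun _ => 1, fun _ => hr, by simp⟩
  | zero => exact ⟨0, fun _ => 0, fun _ => 0, fun _ => I.zero_mem, by simp⟩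
  | add x z _ _ hx hz =>
    obtain ⟨k, a, y, ha, rfl⟩ := hx
    obtain ⟨k', a', y', ha', rfl⟩ := hz
    refine ⟨k + k', Fin.append a a', Fin.append y y', fun l => ?_, by simp [Fin.sum_univ_add]⟩
    induction l using Fin.addCases with
    | left l => simpa using ha l
    | right l => simpa using ha' l
  | smul c x _ hx =>
    obtain ⟨k, a, y, ha, rfl⟩ := hx
    refine ⟨k, a, fun l => c * y l, ha, ?_⟩
    rw [smul_eq_mul, Finset.mul_sum]
    exact Finset.sum_congr rfl fun _ _ => by ring

/-- An étale algebra over a Henselian pair that is finite modulo `I` contains a finite clopen piece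
with the same reduction. -/
theorem exists_isIdempotentElem_finite {R E T : Type*} [CommRing R] [CommRing E] [CommRing T]
    [Algebra R E] [Algebra R T] [Algebra.Etale R E] [Module.Finite R T] (I : Ideal R)
    [HenselianRing R I] (φ : E →ₐ[R] T) (hφI : ∀ r ∈ I, algebraMap R T r = 0)
    (hker : RingHom.ker φ ≤ I.map (algebraMap R E)) :
    ∃ e : E, IsIdempotentElem e ∧ φ e = 1 ∧ Module.Finite R (E ⧸ Ideal.span {1 - e}) := by
  classical
  let B := integralClosure R E
  -- the locus where `Spec E → Spec B` is an open immersion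
  let C : E → Ideal B := fun x =>
    (LinearMap.range (Algebra.linearMap B E)).comap (LinearMap.toSpanSingleton B E x)
  have hC : ∀ x b, b ∈ C x ↔ (b : E) * x ∈ B := by
    intro x b
    constructor
    · rintro ⟨y, hy⟩
      have : (y : E) = (b : E) * x := hy
      rw [← this]
      exact y.2
    · intro h
      exact ⟨⟨_, h⟩, rfl⟩
  let 𝔞 : Ideal B := ⨅ x, (C x).radical
  have h𝔞 : ∀ b ∈ 𝔞, ∀ x, ∃ n : ℕ, (b : E) ^ n * x ∈ B := by
    intro b hb x
    obtain ⟨n, hn⟩ := (Submodule.mem_iInf _).mp hb x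
    exact ⟨n, by simpa using (hC _ _).mp hn⟩
  -- Zariski's main theorem: near each prime of `E`, the algebra `E` agrees with the integral
  -- closure `B` after inverting an element outside that prime.
  have hspan : 𝔞.map (algebraMap B E) = ⊤ := by
    by_contra hne
    obtain ⟨p, hp, hle⟩ := Ideal.exists_le_maximal _ hne
    have := hp.isPrime
    obtain ⟨r, hrp, hr, h⟩ := Algebra.zariskisMainProperty_iff.mp
      (Algebra.ZariskisMainProperty.of_finiteType (R := R) p)
    refine hrp (hle (Ideal.mem_map_of_mem (algebraMap B E) (x := ⟨r, hr⟩) ?_))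
    refine (Submodule.mem_iInf _).mpr fun x => ?_
    obtain ⟨m, hm⟩ := h x
    exact ⟨m, (hC _ _).mpr (by simpa using! hm)⟩
  obtain ⟨j, hj𝔞, hφj⟩ : ∃ j ∈ 𝔞, φ (j : E) = 1 := by
    let _ : Algebra B T := (φ.comp B.val).toAlgebra
    have : IsScalarTower R B T := IsScalarTower.of_algebraMap_eq fun r =>
      ((φ.comp B.val).commutes r).symm
    have : Module.Finite B T := Module.Finite.of_restrictScalars_finite R B T
    have hT : 𝔞.map (algebraMap B T) = ⊤ := by
      have h1 : algebraMap B T = (φ : E →+* T).comp (algebraMap B E) := rfl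
      rw [h1, ← Ideal.map_map, hspan, Ideal.map_top]
    -- As `𝔞T = T` with `T` finite over `B`, Nakayama gives `r ∈ 1 + 𝔞` killing `T`; then `j = 1 -
    -- r`.
    obtain ⟨r, hr, h⟩ := Submodule.exists_sub_one_mem_and_smul_eq_zero_of_fg_of_le_smul 𝔞
      (⊤ : Submodule B T) Module.Finite.fg_top (by rw [Ideal.smul_top_eq_map, hT]; exact le_rfl)
    have h1 := h 1 trivial
    rw [Algebra.smul_def, mul_one] at h1
    have h2 : φ (r : E) = 0 := h1
    refine ⟨1 - r, ?_, by simp [h2]⟩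
    rw [← neg_sub]
    exact 𝔞.neg_mem hr
  have hmem : (1 : E) - j ∈ I.map (algebraMap R E) := hker (by simp [RingHom.mem_ker, hφj])
  obtain ⟨k, a, y, ha, hy⟩ := exists_fin_sum_of_mem_map hmem
  choose n hn using fun l => h𝔞 j hj𝔞 (y l)
  obtain ⟨s, hs⟩ := Algebra.FiniteType.out (R := R) (A := E)
  choose m hm using fun x => h𝔞 j hj𝔞 x
  let N := ∑ l, n l
  -- `B` need not be finite over `R`. Finitely many integral elements suffice: those making `E`
  -- agree with `B₀` up to powers of `j`, and those making `j ^ N (1 - j) ∈ IB₀` visible inside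
  -- `B₀`.
  let gens : Set E := {(j : E)} ∪ Set.range (fun l => (j : E) ^ n l * y l) ∪
    (fun x => (j : E) ^ m x * x) '' (s : Set E)
  have hgens : gens.Finite :=
    ((Set.finite_singleton _).union (Set.finite_range _)).union (s.finite_toSet.image _)
  have hint : ∀ x ∈ gens, IsIntegral R x := by
    rintro x ((rfl | ⟨l, rfl⟩) | ⟨x, -, rfl⟩)
    · exact j.2
    · exact hn l
    · exact hm x
  let B₀ := Algebra.adjoin R gens
  have hfin : Module.Finite R B₀ := ⟨(Submodule.fg_top _).mpr (fg_adjoin_of_finite hgens hint)⟩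
  have hjB : (j : E) ∈ B₀ := Algebra.subset_adjoin (Or.inl (Or.inl rfl))
  let j₀ : B₀ := ⟨j, hjB⟩
  have hsat : ∀ x : E, ∃ (N : ℕ) (b : B₀), B₀.val j₀ ^ N * x = B₀.val b := by
    intro x
    have hx : x ∈ Algebra.adjoin R (s : Set E) := by rw [hs]; trivial
    induction hx using Algebra.adjoin_induction with
    | mem x hx =>
      exact ⟨m x, ⟨_, Algebra.subset_adjoin (Or.inr ⟨x, hx, rfl⟩)⟩, rfl⟩
    | algebraMap r => exact ⟨0, algebraMap R B₀ r, by simp⟩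
    | add x y _ _ hx hy =>
      obtain ⟨N, b, h1⟩ := hx
      obtain ⟨N', b', h2⟩ := hy
      refine ⟨N + N', j₀ ^ N' * b + j₀ ^ N * b', ?_⟩
      simp only [map_add, map_mul, map_pow, ← h1, ← h2]
      ring
    | mul x y _ _ hx hy =>
      obtain ⟨N, b, h1⟩ := hx
      obtain ⟨N', b', h2⟩ := hy
      refine ⟨N + N', b * b', ?_⟩
      simp only [map_mul, ← h1, ← h2]
      ring
  have hjI : j₀ ^ N * (1 - j₀) ∈ I.map (algebraMap R B₀) := by
    let z : Fin k → B₀ := fun l => ⟨_, Algebra.subset_adjoin (Or.inl (Or.inr ⟨l, rfl⟩))⟩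
    have h1 : j₀ ^ N * (1 - j₀) = ∑ l, algebraMap R B₀ (a l) * (j₀ ^ (N - n l) * z l) := by
      apply Subtype.ext
      have h2 : ∀ l, (j : E) ^ N = (j : E) ^ (N - n l) * (j : E) ^ n l := fun l => by
        rw [← pow_add, Nat.sub_add_cancel (Finset.single_le_sum (f := n)
          (fun _ _ => Nat.zero_le _) (Finset.mem_univ l))]
      simp only [z, j₀, MulMemClass.coe_mul, SubmonoidClass.coe_pow, AddSubgroupClass.coe_sub,
        OneMemClass.coe_one, AddSubmonoidClass.coe_finsetSum, Subalgebra.coe_algebraMap]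
      rw [← hy, Finset.mul_sum]
      refine Finset.sum_congr rfl fun l _ => ?_
      rw [h2 l]
      ring
    rw [h1]
    exact Ideal.sum_mem _ fun l _ => Ideal.mul_mem_right _ _ (Ideal.mem_map_of_mem _ (ha l))
  have hidem : j₀ ^ N * j₀ ^ N - j₀ ^ N ∈ I.map (algebraMap R B₀) := by
    obtain ⟨w, hw⟩ := sub_dvd_pow_sub_pow j₀ 1 N
    have : j₀ ^ N * j₀ ^ N - j₀ ^ N = j₀ ^ N * (1 - j₀) * (-w) := by
      rw [one_pow] at hw
      linear_combination j₀ ^ N * hw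
    rw [this]
    exact Ideal.mul_mem_right _ _ hjI
  obtain ⟨e, he, hee⟩ := exists_isIdempotentElem_sub_mem I _ hidem
  refine ⟨B₀.val e, he.map B₀.val, ?_, ?_⟩
  · have h1 : I.map (algebraMap R B₀) ≤ RingHom.ker (φ.comp B₀.val) := by
      rw [Ideal.map_le_iff_le_comap]
      intro r hr
      rw [Ideal.mem_comap, RingHom.mem_ker, AlgHom.commutes]
      exact hφI r hr
    have h2 := h1 hee
    rw [RingHom.mem_ker, map_sub, map_pow, sub_eq_zero] at h2
    have h3 : (φ.comp B₀.val) j₀ = 1 := hφj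
    rw [h3, one_pow] at h2
    exact h2
  · refine finite_quotient_of_isIdempotentElem (I := I) HenselianRing.jac B₀.val e j₀ ?_ hsat
    have : (j₀ - 1) * e = (j₀ - 1) * (e - j₀ ^ N) - j₀ ^ N * (1 - j₀) := by ring
    rw [this]
    exact Ideal.sub_mem _ (Ideal.mul_mem_left _ _ hee) hjI

end HenselianPair

/-! ### Reduction along a Henselian pair is an equivalence -/

namespace HenselianPair

open TensorProduct

section

variable {R S : Type u} [CommRing R] [CommRing S] [Algebra R S]

theorem baseChange_faithful (hS : Function.Surjective (algebraMap R S))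
    [HenselianRing R (RingHom.ker (algebraMap R S))] :
    (CommAlgCat.FiniteEtale.baseChange R S :
      CommAlgCat.FiniteEtale.{u} R ⥤ CommAlgCat.FiniteEtale.{u} S).Faithful where
  map_injective {B C f g} hfg := by
    have h1 : Algebra.TensorProduct.map (.id S S) f.hom.hom =
        Algebra.TensorProduct.map (.id S S) g.hom.hom :=
      congrArg (fun k => k.hom.hom) hfg
    have h2 : f.hom.hom = g.hom.hom := by
      refine algHom_ext_of_comp_eq
        (Algebra.TensorProduct.includeRight : C.obj →ₐ[R] S ⊗[R] C.obj) ?_ ?_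
      · refine le_trans (fun c hc => ?_)
          (map_le_jacobson_bot_of_isIntegral (R := R) (B := C.obj)
            (I := RingHom.ker (algebraMap R S)) HenselianRing.jac)
        exact (includeRight_eq_zero_iff hS c).mp hc
      · ext b
        simpa using DFunLike.congr_fun h1 (1 ⊗ₜ b)
    exact InducedCategory.hom_ext (CommAlgCat.hom_ext h2)

theorem baseChange_full (hS : Function.Surjective (algebraMap R S))
    [HenselianRing R (RingHom.ker (algebraMap R S))] :
    (CommAlgCat.FiniteEtale.baseChange R S :
      CommAlgCat.FiniteEtale.{u} R ⥤ CommAlgCat.FiniteEtale.{u} S).Full where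
  map_surjective {B C} g := by
    let g' : S ⊗[R] B.obj →ₐ[S] S ⊗[R] C.obj := g.hom.hom
    obtain ⟨f, hf⟩ := exists_algHom_lift (S := S)
      (Algebra.TensorProduct.includeRight : C.obj →ₐ[R] S ⊗[R] C.obj)
      (includeRight_surjective hS C.obj)
      (Ideal.ext fun c => includeRight_eq_zero_iff hS c)
      ((g'.restrictScalars R).comp Algebra.TensorProduct.includeRight)
    refine ⟨CommAlgCat.FiniteEtale.ofHom f, ?_⟩
    refine InducedCategory.hom_ext (CommAlgCat.hom_ext ?_)
    change Algebra.TensorProduct.map (.id S S) f = g'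
    ext b
    simpa using DFunLike.congr_fun hf b

/-- An étale lift `E` of `T` may fail to be finite; its finite clopen piece `E/(1 - e)` still
reduces to `T`, since `φ e = 1` and `ker φ ≤ IE`. -/
theorem baseChange_essSurj (hS : Function.Surjective (algebraMap R S))
    [HenselianRing R (RingHom.ker (algebraMap R S))] :
    (CommAlgCat.FiniteEtale.baseChange R S :
      CommAlgCat.FiniteEtale.{u} R ⥤ CommAlgCat.FiniteEtale.{u} S).EssSurj where
  mem_essImage T := by
    let _ : Algebra R T.obj := ((algebraMap S T.obj).comp (algebraMap R S)).toAlgebra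
    have : IsScalarTower R S T.obj := IsScalarTower.of_algebraMap_eq fun _ => rfl
    have : Module.Finite R S := Module.Finite.of_surjective (Algebra.linearMap R S) hS
    have : Module.Finite R T.obj := Module.Finite.trans S T.obj
    obtain ⟨E, _, _, _, φ, hφ, hker⟩ := exists_etale_lift (R := R) (S := S) (T := T.obj) hS
    obtain ⟨e, he, hφe, hfin⟩ := exists_isIdempotentElem_finite (RingHom.ker (algebraMap R S)) φ
      (fun r hr => by
        rw [IsScalarTower.algebraMap_apply R S T.obj, RingHom.mem_ker.mp hr, map_zero]) hker
    have := etale_quotient_of_isIdempotentElem (R := R) he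
    let J := Ideal.span {1 - e}
    have hJ : J ≤ RingHom.ker φ := by
      rw [Ideal.span_le, Set.singleton_subset_iff]
      simp [RingHom.mem_ker, hφe]
    let ψ : E ⧸ J →ₐ[R] T.obj := Ideal.Quotient.liftₐ J φ hJ
    let Ψ : S ⊗[R] (E ⧸ J) →ₐ[S] T.obj :=
      Algebra.TensorProduct.lift (Algebra.ofId S T.obj) ψ fun _ _ => .all _ _
    have hΨ (x : E ⧸ J) : Ψ (1 ⊗ₜ x) = ψ x := by simp [Ψ]
    have hbij : Function.Bijective Ψ := by
      refine ⟨(injective_iff_map_eq_zero Ψ).mpr fun z hz => ?_, fun y => ?_⟩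
      · obtain ⟨x, rfl⟩ := includeRight_surjective hS (E ⧸ J) z
        obtain ⟨x, rfl⟩ := Ideal.Quotient.mk_surjective x
        refine (includeRight_eq_zero_iff hS _).mpr ?_
        have h1 : φ x = 0 := (hΨ _).symm.trans hz
        have h2 := Ideal.mem_map_of_mem (algebraMap E (E ⧸ J)) (hker h1)
        rwa [Ideal.map_map, ← IsScalarTower.algebraMap_eq] at h2
      · obtain ⟨x, rfl⟩ := hφ y
        exact ⟨1 ⊗ₜ Ideal.Quotient.mk _ x, hΨ _⟩
    exact ⟨.of R (E ⧸ J), ⟨CommAlgCat.FiniteEtale.isoMk (AlgEquiv.ofBijective Ψ hbij)⟩⟩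

/-- Reduction modulo `I` is an equivalence on finite étale algebras for a Henselian pair. -/
theorem baseChange_isEquivalence (hS : Function.Surjective (algebraMap R S))
    [HenselianRing R (RingHom.ker (algebraMap R S))] :
    (CommAlgCat.FiniteEtale.baseChange R S :
      CommAlgCat.FiniteEtale.{u} R ⥤ CommAlgCat.FiniteEtale.{u} S).IsEquivalence where
  faithful := baseChange_faithful hS
  full := baseChange_full hS
  essSurj := baseChange_essSurj hS

theorem baseChangeAlong_isEquivalence {A B : Type u} [CommRing A] [CommRing B] (f : A →+* B)
    (hf : Function.Surjective f) (h : HenselianRing A (RingHom.ker f)) :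
    (baseChangeAlong f).IsEquivalence := by
  let _ := f.toAlgebra
  have : HenselianRing A (RingHom.ker (algebraMap A B)) := h
  exact baseChange_isEquivalence hf

end

end HenselianPair

theorem proposition3p30 {p : ℕ} [Fact p.Prime] {R : ℕ → Type u} [∀ i, CommRing (R i)]
    (t : ∀ i, R i →+* R (i + 1)) (I₀ : Ideal (R 0)) (h : IsPerfectoidTower t I₀ p)
    (hensel : ∀ i, HenselianRing (R i) (layerIdeal t I₀ i)) (i : ℕ) :
    ∃ E : CommAlgCat.FiniteEtale.{u} (smallTilt h i) ≌ CommAlgCat.FiniteEtale.{u} (R i),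
      Nonempty (E.functor ⋙ baseChangeAlong (Ideal.Quotient.mk (layerIdeal t I₀ i)) ≅
        baseChangeAlong (smallTiltProj h i)) := by
  have : (baseChangeAlong (Ideal.Quotient.mk (layerIdeal t I₀ i))).IsEquivalence :=
    HenselianPair.baseChangeAlong_isEquivalence _ Ideal.Quotient.mk_surjective
      (by rw [Ideal.mk_ker]; exact hensel i)
  have : (baseChangeAlong (smallTiltProj h i)).IsEquivalence :=
    HenselianPair.baseChangeAlong_isEquivalence _ (HenselianPair.smallTiltProj_surjective h i)
      (HenselianPair.smallTilt_henselianRing h i)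
  let G := baseChangeAlong (Ideal.Quotient.mk (layerIdeal t I₀ i))
  let F := baseChangeAlong (smallTiltProj h i)
  -- The equivalence is `F` followed by the inverse of `G`, so composing with `G` returns `F`
  -- through the counit.
  exact ⟨F.asEquivalence.trans G.asEquivalence.symm,
    ⟨Functor.associator _ _ _ ≪≫ Functor.isoWhiskerLeft F G.asEquivalence.counitIso ≪≫
      F.rightUnitor⟩⟩
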